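/- For a primitive Dirichlet character $\chi$ of conductor $q$, write $\chi=\prod_{p\mid q}\chi^{(p)}$ for its unique factorization into Dirichlet characters $\chi^{(p)}$ of conductor $p^{v_p(q)}$, where $p$ runs over the primes dividing $q$ and $p^{v_p(q)}$ is the exact power of $p$ dividing $q$. A primitive Dirichlet character $\chi$ of order $4$ is called \emph{totally quartic} if each $\chi^{(p)}$ has order exactly $4$. For real $X$, let $\Psi_4^{\mathrm{tot}}(X)$ be the set of totally quartic primitive Dirichlet characters of conductor at most $X$, let $\Psi_4^{\mathrm{tot},\mathrm{odd}}(X)$ be the subset of those with odd conductor, and let $\Psi_4'(X)$ be the set of primitive Dirichlet characters of order $4$ whose conductor is a prime at most $X$. Then there are constants $K_4^{\mathrm{tot}}, K_4^{\mathrm{tot},\mathrm{odd}}>0$ such that, as $X\to\infty$, $$|\Psi_4^{\mathrm{tot}}(X)|\sim K_4^{\mathrm{tot}}X\qquad\text{and}\qquad |\Psi_4^{\mathrm{tot},\mathrm{odd}}(X)|\sim K_4^{\mathrm{tot},\mathrm{odd}}X.$$ Moreover, as $X\to\infty$, $$|\Psi_4'(X)|\sim\frac{X}{\log X}.$$ 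-/

import Mathlib

namespace OrderChar

/-- `χ` of modulus `q` is totally of order `ℓ`: in the factorization `χ = ∏_{p ∣ q} χ⁽ᵖ⁾` into
characters `χ⁽ᵖ⁾` of conductor `p ^ v_p(q)`, every factor has exact order `ℓ`. The factorization is
unique by the Chinese remainder theorem. The character of modulus `1` satisfies this vacuously. -/
def IsTotallyOfOrder {q : ℕ} (χ : DirichletCharacter ℂ q) (ℓ : ℕ) : Prop :=
  ∃ ψ : (p : ℕ) → DirichletCharacter ℂ (p ^ q.factorization p),
    χ = ∏ p ∈ q.primeFactors, DirichletCharacter.changeLevel (Nat.ordProj_dvd q p) (ψ p) ∧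
    ∀ p ∈ q.primeFactors, (ψ p).conductor = p ^ q.factorization p ∧ orderOf (ψ p) = ℓ

/-- `Ψ_ℓ`: all primitive Dirichlet characters (of positive modulus) of order `ℓ`. -/
def Psi (ℓ : ℕ) : Set (Σ q : ℕ, DirichletCharacter ℂ q) :=
  {χ | 0 < χ.1 ∧ χ.2.IsPrimitive ∧ orderOf χ.2 = ℓ}

/-- `Ψ_ℓ^tot`: the characters in `Ψ_ℓ` that are totally of order `ℓ`. -/
def PsiTot (ℓ : ℕ) : Set (Σ q : ℕ, DirichletCharacter ℂ q) :=
  {χ | χ ∈ Psi ℓ ∧ IsTotallyOfOrder χ.2 ℓ}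

/-- `Ψ_ℓ^{tot,odd}`: the characters in `Ψ_ℓ^tot` of odd conductor. -/
def PsiTotOdd (ℓ : ℕ) : Set (Σ q : ℕ, DirichletCharacter ℂ q) :=
  {χ | χ ∈ PsiTot ℓ ∧ Odd χ.2.conductor}

/-- `Ψ_ℓ'`: the characters in `Ψ_ℓ` of prime conductor. -/
def PsiPrime (ℓ : ℕ) : Set (Σ q : ℕ, DirichletCharacter ℂ q) :=
  {χ | χ ∈ Psi ℓ ∧ χ.2.conductor.Prime}

/-- `Ψ(X)`: the members of the family `Ψ` of conductor at most `X`. -/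
def upTo (Ψ : Set (Σ q : ℕ, DirichletCharacter ℂ q)) (X : ℝ) :
    Set (Σ q : ℕ, DirichletCharacter ℂ q) :=
  {χ | χ ∈ Ψ ∧ (χ.2.conductor : ℝ) ≤ X}

/-- The sets counted below are finite, so their `Set.ncard` is the true cardinality. -/
theorem finite_upTo {Ψ : Set (Σ q : ℕ, DirichletCharacter ℂ q)} {ℓ : ℕ} (h : Ψ ⊆ Psi ℓ) (X : ℝ) :
    (upTo Ψ X).Finite := by
  have hfin : (⋃ q ∈ Finset.Icc 1 ⌊X⌋₊,
      Set.range (fun χ : DirichletCharacter ℂ q ↦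
        (⟨q, χ⟩ : Σ q : ℕ, DirichletCharacter ℂ q))).Finite := by
    refine Set.Finite.biUnion (Finset.finite_toSet _) fun q hq ↦ ?_
    have : NeZero q := ⟨by have := (Finset.mem_Icc.mp hq).1; omega⟩
    exact Set.finite_range _
  refine hfin.subset ?_
  rintro ⟨q, χ⟩ ⟨hχ, hX⟩
  obtain ⟨h0, hp, -⟩ := h hχ
  have hp' : χ.conductor = q := hp
  simp only [hp'] at hX
  simp only [Set.mem_iUnion, Finset.mem_Icc]
  exact ⟨q, ⟨h0, Nat.le_floor hX⟩, χ, rfl⟩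

end OrderChar

/-! A totally quartic character of level `q` is a free choice, for each prime `p ∣ q`, of a
primitive character of order 4 and level `p ^ v_p(q)` (`ncard_totalChars`). There are 2 such
characters at level `p` when `p ≡ 1` mod 4, there are 4 at level `2 ^ 4`, and none at any other
prime power (`ncard_localChars_four`). So for `q > 1` the count is a multiplicative function of `q`,
and its Dirichlet series is `ζ(s) L(s, χ₄)` times an Euler product that converges absolutely at `s =
1`.

The summatory function of `χ₄ * ζ` grows like `(π / 4) N`, by Leibniz' series. Convolving with a
function `f` such that `∑ |f n| / n < ∞` multiplies this mean value by `∑ f n / n`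
(`tendsto_sum_mul_div`), which is positive as an Euler product with positive factors. This gives
both linear asymptotics, odd conductors corresponding to weight 0 at `2 ^ 4`.

For prime conductors the count is twice the number of primes `p ≡ 1` mod 4 up to `X`, so the claim
is the prime number theorem modulo 4. It comes from a Wiener–Ikehara theorem, proved with the Fejér
kernel, applied to the logarithmic derivatives of Dirichlet `L`-functions, whose regularity up to
the line `Re s = 1` is `continuousOn_LFunctionResidueClassAux`. -/

/-! ### The Fejér kernel -/

namespace WienerIkehara

open MeasureTheory Filter Topology Set

/-- The Fejér kernel `(1 - cos (l v)) / (l v²)`. -/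
noncomputable def fejer (l v : ℝ) : ℝ := (1 - Real.cos (l * v)) / (l * v ^ 2)

lemma fejer_nonneg {l : ℝ} (hl : 0 < l) (v : ℝ) : 0 ≤ fejer l v :=
  div_nonneg (by linarith [Real.cos_le_one (l * v)]) (by positivity)

lemma fejer_eq_mul_fejer_one {l : ℝ} (hl : 0 < l) (v : ℝ) : fejer l v = l * fejer 1 (l * v) := by
  rcases eq_or_ne v 0 with rfl | hv
  · simp [fejer]
  · simp only [fejer]
    field_simp

/-- The two summands come from `1 - cos x ≤ x² / 2`, useful near 0, and `1 - cos x ≤ 2`, useful far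
away. -/
lemma fejer_le {l : ℝ} (hl : 0 < l) (v : ℝ) : fejer l v ≤ (l / 2 + 2 / l) * (1 + v ^ 2)⁻¹ := by
  rw [← div_eq_mul_inv, le_div_iff₀ (by positivity), mul_add, mul_one]
  rcases eq_or_ne v 0 with rfl | hv
  · simp [fejer]; positivity
  · refine add_le_add ?_ ?_
    · rw [fejer, div_le_iff₀ (by positivity)]
      nlinarith [Real.one_sub_sq_div_two_le_cos (x := l * v)]
    · rw [fejer]
      field_simp
      linarith [Real.neg_one_le_cos (l * v)]

@[fun_prop]
lemma measurable_fejer (l : ℝ) : Measurable (fejer l) := by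
  unfold fejer
  fun_prop

lemma integrable_fejer {l : ℝ} (hl : 0 < l) : Integrable (fejer l) := by
  refine (integrable_inv_one_add_sq.const_mul (l / 2 + 2 / l)).mono'
    (measurable_fejer l).aestronglyMeasurable (.of_forall fun v ↦ ?_)
  rw [Real.norm_of_nonneg (fejer_nonneg hl v)]
  exact fejer_le hl v

/-- The kernel is the cosine transform of a triangle. The point `v = 0` is excluded because division
by zero gives `fejer l 0 = 0`, while the integral there is `l / 2`; a single point does not affect
the integrals below. -/
lemma integral_mul_cos_eq_fejer {l v : ℝ} (hl : 0 < l) (hv : v ≠ 0) :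
    ∫ y in (0 : ℝ)..l, (1 - y / l) * Real.cos (y * v) = fejer l v := by
  have h (y : ℝ) : HasDerivAt (fun y ↦ (1 - y / l) * (Real.sin (y * v) / v)
      - Real.cos (y * v) / (l * v ^ 2)) ((1 - y / l) * Real.cos (y * v)) y := by
    have h1 : HasDerivAt (fun y ↦ y * v) v y := by simpa using (hasDerivAt_id y).mul_const v
    have h2 : HasDerivAt (fun y ↦ 1 - y / l) (-(1 / l)) y := by
      simpa using ((hasDerivAt_id y).div_const l).const_sub 1
    refine ((h2.fun_mul (h1.sin.div_const v)).fun_sub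
      (h1.cos.div_const (l * v ^ 2))).congr_deriv ?_
    field_simp
    ring
  rw [intervalIntegral.integral_eq_sub_of_hasDerivAt (fun y _ ↦ h y)
    (Continuous.intervalIntegrable (by fun_prop) _ _)]
  simp only [fejer]
  field_simp
  simp
  ring

lemma integral_fejer {l : ℝ} (hl : 0 < l) : ∫ v, fejer l v = ∫ v, fejer 1 v := by
  simp_rw [fejer_eq_mul_fejer_one hl]
  rw [integral_const_mul, Measure.integral_comp_mul_left, abs_of_pos (inv_pos.mpr hl), smul_eq_mul,
    mul_inv_cancel_left₀ hl.ne']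

lemma intervalIntegral_fejer {l : ℝ} (hl : 0 < l) (d : ℝ) :
    ∫ v in (-d)..d, fejer l v = ∫ v in (-(l * d))..(l * d), fejer 1 v := by
  simp_rw [fejer_eq_mul_fejer_one hl]
  rw [intervalIntegral.integral_const_mul, intervalIntegral.integral_comp_mul_left _ hl.ne',
    smul_eq_mul, mul_inv_cancel_left₀ hl.ne', mul_neg]

lemma integral_fejer_pos : 0 < ∫ v, fejer 1 v := by
  rw [integral_pos_iff_support_of_nonneg (fejer_nonneg one_pos) (integrable_fejer one_pos)]
  refine lt_of_lt_of_le (?_ : 0 < volume (Ioo (1 : ℝ) 2)) (measure_mono fun v hv ↦ ?_)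
  · simp
  · have h1 : Real.cos v < Real.cos 0 :=
      Real.cos_lt_cos_of_nonneg_of_le_pi le_rfl (by linarith [hv.2, Real.pi_gt_three])
        (by linarith [hv.1])
    have hv' : 0 < v := by linarith [hv.1]
    simp only [Function.mem_support, fejer, one_mul]
    rw [Real.cos_zero] at h1
    exact (div_pos (by linarith) (by positivity)).ne'

/-! ### Convolution with the Fejér kernel -/

section Limit

variable {D : ℝ → ℝ} {M : ℝ} {G : ℂ → ℂ} {l : ℝ}

lemma re_mul_cexp_eq_integral (hD : Measurable D) (hM : ∀ t, |D t| ≤ M)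
    (hGD : ∀ s : ℂ, 0 < s.re → G s = ∫ t in Ioi 0, (D t : ℂ) * Complex.exp (-s * t))
    {σ : ℝ} (hσ : 0 < σ) (u y : ℝ) :
    (G (σ + y * Complex.I) * Complex.exp (y * u * Complex.I)).re =
      ∫ t in Ioi 0, Real.exp (-σ * t) * (D t * Real.cos (y * (u - t))) := by
  rw [hGD _ (by simpa using hσ), ← integral_mul_const]
  have hint : Integrable (fun t : ℝ ↦ (D t : ℂ) * Complex.exp (-(σ + y * Complex.I) * t) *
      Complex.exp (y * u * Complex.I)) (volume.restrict (Ioi 0)) := by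
    refine ((exp_neg_integrableOn_Ioi 0 hσ).const_mul M).mono' (by fun_prop)
      (.of_forall fun t ↦ ?_)
    rw [norm_mul, norm_mul, Complex.norm_exp, Complex.norm_exp, Complex.norm_real]
    simpa using mul_le_mul_of_nonneg_right (hM t) (Real.exp_pos _).le
  refine (integral_re hint).symm.trans (integral_congr_ae (.of_forall fun t ↦ ?_))
  have : (D t : ℂ) * Complex.exp (-(σ + y * Complex.I) * t) * Complex.exp (y * u * Complex.I)
      = ((Real.exp (-σ * t) * D t : ℝ) : ℂ) * Complex.exp ((y * (u - t) : ℝ) * Complex.I) := by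
    push_cast
    rw [mul_assoc (D t : ℂ), ← Complex.exp_add, mul_comm (Complex.exp _) (D t : ℂ),
      mul_assoc (D t : ℂ), ← Complex.exp_add]
    ring_nf
  simp only [this]
  rw [RCLike.re_eq_complex_re, Complex.re_ofReal_mul, Complex.exp_ofReal_mul_I_re, mul_assoc]

/-- Fubini, justified by the factor `exp (-σ t)` with `σ > 0`; the inner integral over `y` is the
Fejér kernel. -/
lemma integral_re_mul_cexp (hD : Measurable D) (hM : ∀ t, |D t| ≤ M)
    (hGD : ∀ s : ℂ, 0 < s.re → G s = ∫ t in Ioi 0, (D t : ℂ) * Complex.exp (-s * t))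
    (hl : 0 < l) {σ : ℝ} (hσ : 0 < σ) (u : ℝ) :
    ∫ y in (0 : ℝ)..l, (1 - y / l) * (G (σ + y * Complex.I) * Complex.exp (y * u * Complex.I)).re =
      ∫ t in Ioi 0, Real.exp (-σ * t) * (D t * fejer l (u - t)) := by
  simp_rw [re_mul_cexp_eq_integral hD hM hGD hσ u, intervalIntegral.integral_of_le hl.le,
    ← integral_const_mul]
  rw [integral_integral_swap]
  · refine integral_congr_ae ?_
    have : ∀ᵐ t ∂(volume.restrict (Ioi (0 : ℝ))), t ≠ u := by
      refine ae_restrict_of_ae ?_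
      simp [ae_iff]
    filter_upwards [this] with t ht
    rw [← integral_mul_cos_eq_fejer hl (sub_ne_zero.mpr ht.symm),
      intervalIntegral.integral_of_le hl.le, ← integral_const_mul, ← integral_const_mul]
    refine integral_congr_ae (.of_forall fun y ↦ ?_)
    ring
  · have hc : Integrable (fun _ : ℝ ↦ M) (volume.restrict (Ioc 0 l)) := by
      simp
    refine (hc.mul_prod (exp_neg_integrableOn_Ioi 0 hσ)).mono' ?_ ?_
    · refine Measurable.aestronglyMeasurable ?_
      simp only [Function.uncurry_def]
      fun_prop
    · rw [Measure.prod_restrict]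
      refine (ae_restrict_iff' (measurableSet_Ioc.prod measurableSet_Ioi)).mpr
        (.of_forall fun p hp ↦ ?_)
      have h1 : |1 - p.1 / l| ≤ 1 := by
        have h0 : 0 ≤ p.1 / l := div_nonneg hp.1.1.le hl.le
        have : p.1 / l ≤ 1 := (div_le_one hl).mpr hp.1.2
        rw [abs_le]; constructor <;> linarith
      have h2 := Real.abs_cos_le_one (p.1 * (u - p.2))
      simp only [Function.uncurry_def, norm_mul, Real.norm_eq_abs, Real.abs_exp]
      have hM0 : 0 ≤ M := (abs_nonneg _).trans (hM 0)
      calc |1 - p.1 / l| * (Real.exp (-σ * p.2) * (|D p.2| * |Real.cos (p.1 * (u - p.2))|))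
          ≤ 1 * (Real.exp (-σ * p.2) * (M * 1)) := by gcongr; exact hM _
        _ = _ := by ring

/-- Let `σ → 0+` in the previous identity. On the left `G` is bounded on the compact rectangle `[0,
1] × [0, l]`; on the right `M * fejer l (u - t)` dominates. -/
lemma integral_mul_fejer_eq (hD : Measurable D) (hM : ∀ t, |D t| ≤ M)
    (hG : ContinuousOn G {s | 0 ≤ s.re})
    (hGD : ∀ s : ℂ, 0 < s.re → G s = ∫ t in Ioi 0, (D t : ℂ) * Complex.exp (-s * t))
    (hl : 0 < l) (u : ℝ) :
    ∫ y in (0 : ℝ)..l, (1 - y / l) * (G (y * Complex.I) * Complex.exp (y * u * Complex.I)).re =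
      ∫ t in Ioi 0, D t * fejer l (u - t) := by
  have hM0 : 0 ≤ M := (abs_nonneg _).trans (hM 0)
  have hpath : ContinuousOn (fun p : ℝ × ℝ ↦ G (p.1 + p.2 * Complex.I)) (Ici 0 ×ˢ univ) :=
    hG.comp (by fun_prop) fun p hp ↦ by simpa using hp.1
  obtain ⟨C, hC⟩ := (isCompact_Icc.prod isCompact_Icc).exists_bound_of_continuousOn
    (hpath.mono (prod_mono (fun x hx ↦ hx.1 : Icc (0 : ℝ) 1 ⊆ Ici 0) (subset_univ (Icc 0 l))))
  have hL : Tendsto (fun σ : ℝ ↦ ∫ y in (0 : ℝ)..l, (1 - y / l) *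
      (G (σ + y * Complex.I) * Complex.exp (y * u * Complex.I)).re) (𝓝[>] 0)
      (𝓝 (∫ y in (0 : ℝ)..l, (1 - y / l) *
        (G (y * Complex.I) * Complex.exp (y * u * Complex.I)).re)) := by
    refine intervalIntegral.tendsto_integral_filter_of_dominated_convergence (fun _ ↦ C) ?_ ?_
      (by simp) ?_
    · filter_upwards [self_mem_nhdsWithin] with σ hσ
      have : Continuous fun y : ℝ ↦ G (σ + y * Complex.I) := by
        refine continuousOn_univ.mp (hpath.comp (f := fun y : ℝ ↦ (σ, y)) (by fun_prop) ?_)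
        exact fun y _ ↦ mk_mem_prod (mem_Ici.mpr (le_of_lt hσ)) (mem_univ _)
      exact (Continuous.mul (by fun_prop)
        (Complex.continuous_re.comp (this.mul (by fun_prop)))).aestronglyMeasurable
    · filter_upwards [Ioo_mem_nhdsGT one_pos] with σ hσ
      refine .of_forall fun y hy ↦ ?_
      rw [uIoc_of_le hl.le] at hy
      have h1 : |1 - y / l| ≤ 1 := by
        have h0 : 0 ≤ y / l := div_nonneg hy.1.le hl.le
        have : y / l ≤ 1 := (div_le_one hl).mpr hy.2
        rw [abs_le]; constructor <;> linarith
      have h2 : ‖G (σ + y * Complex.I)‖ ≤ C :=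
        hC (σ, y) ⟨⟨hσ.1.le, hσ.2.le⟩, ⟨hy.1.le, hy.2⟩⟩
      have h3 : |(G (σ + y * Complex.I) * Complex.exp (y * u * Complex.I)).re| ≤ C := by
        refine (Complex.abs_re_le_norm _).trans ?_
        rw [norm_mul, ← Complex.ofReal_mul, Complex.norm_exp_ofReal_mul_I, mul_one]
        exact h2
      rw [norm_mul, Real.norm_eq_abs, Real.norm_eq_abs]
      calc _ ≤ 1 * C := by gcongr
        _ = C := one_mul C
    · refine .of_forall fun y hy ↦ ?_
      have : Tendsto (fun σ : ℝ ↦ G (σ + y * Complex.I)) (𝓝[>] 0) (𝓝 (G (y * Complex.I))) := by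
        have h := (hpath (0, y) (mk_mem_prod self_mem_Ici (mem_univ _))).tendsto.comp
          (f := fun σ : ℝ ↦ (σ, y)) (x := 𝓝[>] 0) ?_
        · simpa [Function.comp_def] using h
        · refine tendsto_nhdsWithin_iff.mpr ⟨?_, ?_⟩
          · exact (Continuous.tendsto (by fun_prop : Continuous fun σ : ℝ ↦ (σ, y)) 0).mono_left
              nhdsWithin_le_nhds
          · filter_upwards [self_mem_nhdsWithin] with σ hσ
            exact mk_mem_prod (mem_Ici.mpr (le_of_lt hσ)) (mem_univ _)
      exact ((Complex.continuous_re.tendsto _).comp (this.mul_const _)).const_mul _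
  have hR : Tendsto (fun σ : ℝ ↦ ∫ t in Ioi 0, Real.exp (-σ * t) * (D t * fejer l (u - t)))
      (𝓝[>] 0) (𝓝 (∫ t in Ioi 0, D t * fejer l (u - t))) := by
    refine tendsto_integral_filter_of_dominated_convergence (fun t ↦ M * fejer l (u - t)) ?_ ?_
      (((integrable_fejer hl).comp_sub_left u).const_mul M).integrableOn ?_
    · exact .of_forall fun σ ↦ Measurable.aestronglyMeasurable (by fun_prop)
    · filter_upwards [self_mem_nhdsWithin] with σ hσ
      refine (ae_restrict_iff' measurableSet_Ioi).mpr (.of_forall fun t ht ↦ ?_)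
      have h0 := fejer_nonneg hl (u - t)
      have h1 : Real.exp (-σ * t) ≤ 1 := by
        rw [Real.exp_le_one_iff]
        nlinarith [mem_Ioi.mp hσ, mem_Ioi.mp ht]
      rw [norm_mul, norm_mul, Real.norm_of_nonneg h0, Real.norm_eq_abs, Real.abs_exp,
        Real.norm_eq_abs]
      calc _ ≤ 1 * (M * fejer l (u - t)) := by gcongr; exact hM t
        _ = _ := one_mul _
    · refine .of_forall fun t ↦ ?_
      have : Tendsto (fun σ : ℝ ↦ Real.exp (-σ * t) * (D t * fejer l (u - t))) (𝓝 0)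
          (𝓝 (Real.exp (-0 * t) * (D t * fejer l (u - t)))) :=
        Continuous.tendsto (by fun_prop) 0
      simpa using this.mono_left nhdsWithin_le_nhds
  refine tendsto_nhds_unique hL (hR.congr' ?_)
  filter_upwards [self_mem_nhdsWithin] with σ hσ
  exact (integral_re_mul_cexp hD hM hGD hl hσ u).symm

/-- By the previous identity this is the real part of a Fourier integral of a continuous function on
a bounded interval, so the Riemann–Lebesgue lemma applies. -/
lemma tendsto_integral_mul_fejer (hD : Measurable D) (hM : ∀ t, |D t| ≤ M)
    (hG : ContinuousOn G {s | 0 ≤ s.re})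
    (hGD : ∀ s : ℂ, 0 < s.re → G s = ∫ t in Ioi 0, (D t : ℂ) * Complex.exp (-s * t))
    (hl : 0 < l) :
    Tendsto (fun u ↦ ∫ t in Ioi 0, D t * fejer l (u - t)) atTop (𝓝 0) := by
  have hGc : Continuous fun y : ℝ ↦ G (y * Complex.I) := by
    refine continuousOn_univ.mp (hG.comp (by fun_prop) fun y _ ↦ by simp)
  have hRL := Real.tendsto_integral_exp_smul_cocompact
    ((Ioc 0 l).indicator fun y : ℝ ↦ ((1 - y / l : ℝ) : ℂ) * G (y * Complex.I))
  -- The frequency is rescaled because `Real.fourierChar` carries a factor `2 π`.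
  have hw : Tendsto (fun u : ℝ ↦ -(u / (2 * Real.pi))) atTop (cocompact ℝ) :=
    (tendsto_neg_atTop_atBot.comp (tendsto_id.atTop_div_const (by positivity))).mono_right
      atBot_le_cocompact
  refine Tendsto.congr (fun u ↦ ?_) ((Complex.continuous_re.tendsto _).comp (hRL.comp hw))
  rw [← integral_mul_fejer_eq hD hM hG hGD hl, intervalIntegral.integral_of_le hl.le]
  simp only [Function.comp_apply]
  have hind (y : ℝ) : Real.fourierChar (-(y * -(u / (2 * Real.pi)))) •
      (Ioc 0 l).indicator (fun y : ℝ ↦ ((1 - y / l : ℝ) : ℂ) * G (y * Complex.I)) y =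
      (Ioc 0 l).indicator (fun y : ℝ ↦ ((1 - y / l : ℝ) : ℂ) *
        (G (y * Complex.I) * Complex.exp (y * u * Complex.I))) y := by
    rw [Circle.smul_def, Real.fourierChar_apply,
      show 2 * Real.pi * -(y * -(u / (2 * Real.pi))) = y * u by field_simp]
    by_cases hy : y ∈ Ioc 0 l
    · simp only [indicator_of_mem hy, smul_eq_mul]
      push_cast
      ring
    · simp [indicator_of_notMem hy]
  rw [integral_congr_ae (.of_forall hind), integral_indicator measurableSet_Ioc]
  refine (integral_re (𝕜 := ℂ) ?_).symm.trans (integral_congr_ae (.of_forall fun y ↦ ?_))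
  · exact (Continuous.integrableOn_Icc (Continuous.mul (by fun_prop)
      (hGc.mul (by fun_prop)))).mono_set Ioc_subset_Icc_self
  · rw [RCLike.re_eq_complex_re]
    exact Complex.re_ofReal_mul _ _

end Limit

/-! ### The Tauberian theorem -/

section Tauberian

variable {B : ℝ → ℝ} {A M : ℝ} {l d u : ℝ}

lemma tendsto_setIntegral_fejer (hl : 0 < l) :
    Tendsto (fun u ↦ ∫ t in Ioi 0, fejer l (u - t)) atTop (𝓝 (∫ v, fejer 1 v)) := by
  have h (u : ℝ) : ∫ t in Ioi 0, fejer l (u - t) = ∫ v, (Iio u).indicator (fejer l) v := by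
    rw [← integral_sub_left_eq_self (fun v ↦ (Iio u).indicator (fejer l) v) volume u,
      ← integral_indicator measurableSet_Ioi]
    refine integral_congr_ae (.of_forall fun t ↦ ?_)
    simp [indicator]
  simp_rw [h, ← integral_fejer hl]
  refine tendsto_integral_filter_of_dominated_convergence (fejer l) ?_ ?_ (integrable_fejer hl) ?_
  · exact .of_forall fun u ↦
      ((measurable_fejer l).indicator measurableSet_Iio).aestronglyMeasurable
  · refine .of_forall fun u ↦ .of_forall fun v ↦ (norm_indicator_le_norm_self _ _).trans ?_
    rw [Real.norm_of_nonneg (fejer_nonneg hl v)]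
  · refine .of_forall fun v ↦ tendsto_const_nhds.congr' ?_
    filter_upwards [eventually_gt_atTop v] with u hu
    rw [indicator_of_mem (mem_Iio.mpr hu)]

lemma integrable_mul_fejer (hB : Measurable B) (hB0 : ∀ t, 0 ≤ B t) (hBM : ∀ t, B t ≤ M)
    (hl : 0 < l) (u : ℝ) : Integrable fun t ↦ B t * fejer l (u - t) := by
  refine (((integrable_fejer hl).comp_sub_left u).const_mul M).mono'
    (Measurable.aestronglyMeasurable (by fun_prop)) (.of_forall fun t ↦ ?_)
  have h0 := fejer_nonneg hl (u - t)
  rw [norm_mul, Real.norm_of_nonneg h0, Real.norm_of_nonneg (hB0 t)]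
  gcongr
  exact hBM t

/-- Since `B t * exp t` is monotone, `B` cannot fall below `B u * exp (-2d)` on the window `(u, u +
2d]`, whose midpoint is the centre of the kernel. The rest of the integral is nonnegative. -/
lemma mul_integral_fejer_le (hB : Measurable B) (hB0 : ∀ t, 0 ≤ B t) (hBM : ∀ t, B t ≤ M)
    (hmono : ∀ u t, u ≤ t → B u * Real.exp u ≤ B t * Real.exp t) (hl : 0 < l) (hd : 0 < d)
    (hu : 0 ≤ u) :
    B u * Real.exp (-(2 * d)) * ∫ v in (-d)..d, fejer l v ≤
      ∫ t in Ioi 0, B t * fejer l (u + d - t) := by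
  have h1 : ∫ v in (-d)..d, fejer l v = ∫ t in Ioc u (u + 2 * d), fejer l (u + d - t) := by
    rw [← intervalIntegral.integral_of_le (by linarith),
      intervalIntegral.integral_comp_sub_left (fejer l)]
    congr 1 <;> ring
  rw [h1, ← integral_const_mul]
  have hint := integrable_mul_fejer hB hB0 hBM hl (u + d)
  refine (setIntegral_mono_on ?_ hint.integrableOn measurableSet_Ioc fun t ht ↦ ?_).trans
    (setIntegral_mono_set hint.integrableOn ?_ (LE.le.eventuallyLE ?_))
  · exact (((integrable_fejer hl).comp_sub_left _).const_mul _).integrableOn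
  · refine mul_le_mul_of_nonneg_right ?_ (fejer_nonneg hl _)
    have h2 := hmono u t ht.1.le
    have h3 : Real.exp t ≤ Real.exp u * Real.exp (2 * d) := by
      rw [← Real.exp_add]
      exact Real.exp_le_exp.mpr ht.2
    rw [Real.exp_neg, ← div_eq_mul_inv, div_le_iff₀ (Real.exp_pos _)]
    refine le_of_mul_le_mul_right ?_ (Real.exp_pos u)
    calc _ ≤ B t * Real.exp t := h2
      _ ≤ B t * (Real.exp u * Real.exp (2 * d)) := by gcongr; exact hB0 t
      _ = _ := by ring
  · exact .of_forall fun t ↦ mul_nonneg (hB0 t) (fejer_nonneg hl _)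
  · exact fun t ht ↦ lt_of_le_of_lt hu ht.1

/-- The mirror image: on `(u - 2d, u]` monotonicity bounds `B` by `B u * exp (2d)`, and off this
window only `B ≤ M` is used, at the cost of the tail of the kernel. -/
lemma integral_mul_fejer_le (hB : Measurable B) (hB0 : ∀ t, 0 ≤ B t) (hBM : ∀ t, B t ≤ M)
    (hmono : ∀ u t, u ≤ t → B u * Real.exp u ≤ B t * Real.exp t) (hl : 0 < l) (hd : 0 < d)
    (u : ℝ) :
    ∫ t in Ioi 0, B t * fejer l (u - d - t) ≤
      B u * Real.exp (2 * d) * (∫ v, fejer 1 v) +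
        M * ((∫ v, fejer 1 v) - ∫ v in (-d)..d, fejer l v) := by
  have hM0 : 0 ≤ M := (hB0 0).trans (hBM 0)
  set f : ℝ → ℝ := fun t ↦ fejer l (u - d - t) with hf
  have hfi : Integrable f := (integrable_fejer hl).comp_sub_left _
  have hf0 (t : ℝ) : 0 ≤ f t := fejer_nonneg hl _
  have hS : MeasurableSet (Ioc (u - 2 * d) u) := measurableSet_Ioc
  have h1 : ∫ v in (-d)..d, fejer l v = ∫ t, (Ioc (u - 2 * d) u).indicator f t := by
    rw [integral_indicator hS, ← intervalIntegral.integral_of_le (by linarith),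
      intervalIntegral.integral_comp_sub_left (fejer l)]
    congr 1 <;> ring
  have h2 : ∫ v, fejer 1 v = ∫ t, f t := by
    rw [← integral_fejer hl, hf, integral_sub_left_eq_self (fejer l)]
  have hI1 : Integrable fun t ↦ B u * Real.exp (2 * d) * f t := hfi.const_mul _
  have hI2 : Integrable fun t ↦ f t - (Ioc (u - 2 * d) u).indicator f t :=
    hfi.sub (hfi.indicator hS)
  have hle (t : ℝ) : (Ioc (u - 2 * d) u).indicator f t ≤ f t :=
    indicator_le_self' (fun t _ ↦ hf0 t) t
  rw [h1, h2, ← integral_const_mul, ← integral_sub hfi (hfi.indicator hS),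
    ← integral_const_mul, ← integral_add hI1 (hI2.const_mul M)]
  have hpt (t : ℝ) : B t * f t ≤
      B u * Real.exp (2 * d) * f t + M * (f t - (Ioc (u - 2 * d) u).indicator f t) := by
    by_cases ht : t ∈ Ioc (u - 2 * d) u
    · rw [indicator_of_mem ht, sub_self, mul_zero, add_zero]
      refine mul_le_mul_of_nonneg_right ?_ (hf0 t)
      have h3 : Real.exp u ≤ Real.exp (2 * d) * Real.exp t := by
        rw [← Real.exp_add]
        exact Real.exp_le_exp.mpr (by linarith [ht.1])
      refine le_of_mul_le_mul_right ?_ (Real.exp_pos t)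
      calc _ ≤ B u * Real.exp u := hmono t u ht.2
        _ ≤ B u * (Real.exp (2 * d) * Real.exp t) := by gcongr; exact hB0 u
        _ = _ := by ring
    · rw [indicator_of_notMem ht, sub_zero]
      have := mul_le_mul_of_nonneg_right (hBM t) (hf0 t)
      have h4 : 0 ≤ B u * Real.exp (2 * d) * f t :=
        mul_nonneg (mul_nonneg (hB0 u) (Real.exp_pos _).le) (hf0 t)
      linarith
  refine (setIntegral_mono (integrable_mul_fejer hB hB0 hBM hl _).integrableOn
    (hI1.add (hI2.const_mul M)).integrableOn hpt).trans
    (setIntegral_le_integral (hI1.add (hI2.const_mul M)) (.of_forall fun t ↦ ?_))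
  exact add_nonneg (mul_nonneg (mul_nonneg (hB0 u) (Real.exp_pos _).le) (hf0 t))
    (mul_nonneg hM0 (sub_nonneg.mpr (hle t)))

/-- A form of the **Wiener–Ikehara theorem**: if `B` is bounded, `B t * exp t` is monotone and the
Laplace transform of `B - A` extends continuously to the closed right half plane, then
`B` tends to `A`. -/
theorem tendsto_of_continuousOn_laplace {G : ℂ → ℂ} (hB : Measurable B) (hB0 : ∀ t, 0 ≤ B t)
    (hBM : ∀ t, B t ≤ M) (hmono : ∀ u t, u ≤ t → B u * Real.exp u ≤ B t * Real.exp t)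
    (hG : ContinuousOn G {s | 0 ≤ s.re})
    (hGB : ∀ s : ℂ, 0 < s.re →
      G s = ∫ t in Ioi 0, ((B t - A : ℝ) : ℂ) * Complex.exp (-s * t)) :
    Tendsto B atTop (𝓝 A) := by
  set c := ∫ v, fejer 1 v with hc
  have hc0 : 0 < c := integral_fejer_pos
  have hI {l : ℝ} (hl : 0 < l) :
      Tendsto (fun u ↦ ∫ t in Ioi 0, B t * fejer l (u - t)) atTop (𝓝 (A * c)) := by
    have h1 := tendsto_integral_mul_fejer (D := fun t ↦ B t - A) (M := M + |A|) (by fun_prop)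
      (fun t ↦ (abs_sub _ _).trans (by rw [abs_of_nonneg (hB0 t)]; linarith [hBM t])) hG hGB hl
    have h2 := (tendsto_setIntegral_fejer hl).const_mul A
    rw [← zero_add (A * c)]
    refine (h1.add h2).congr fun u ↦ ?_
    rw [← integral_const_mul, ← integral_add]
    · refine integral_congr_ae (.of_forall fun t ↦ ?_)
      ring
    · simp_rw [sub_mul]
      exact ((integrable_mul_fejer hB hB0 hBM hl u).sub
        (((integrable_fejer hl).comp_sub_left u).const_mul A)).integrableOn
    · exact (((integrable_fejer hl).comp_sub_left u).const_mul A).integrableOn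
  have hm : Tendsto (fun R : ℝ ↦ ∫ v in (-R)..R, fejer 1 v) atTop (𝓝 c) :=
    intervalIntegral_tendsto_integral (integrable_fejer one_pos) tendsto_neg_atTop_atBot tendsto_id
  -- The choice `d = R⁻¹`, `l = R ^ 2` makes the window shrink while `l * d = R` grows, so that the
  -- window captures almost all the mass of the kernel.
  have hscale {R : ℝ} (hR : 0 < R) :
      ∫ v in (-R⁻¹)..R⁻¹, fejer (R ^ 2) v = ∫ v in (-R)..R, fejer 1 v := by
    rw [intervalIntegral_fejer (by positivity), show R ^ 2 * R⁻¹ = R by field_simp]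
  have hinv : Tendsto (fun R : ℝ ↦ R⁻¹) atTop (𝓝 0) := tendsto_inv_atTop_zero
  rw [tendsto_order]
  constructor
  · intro a ha
    have hlim : Tendsto (fun R : ℝ ↦ (A * c - R⁻¹ - M * (c - ∫ v in (-R)..R, fejer 1 v)) /
        (Real.exp (2 * R⁻¹) * c)) atTop (𝓝 ((A * c - 0 - M * (c - c)) /
          (Real.exp (2 * 0) * c))) :=
      ((hinv.const_sub _).sub ((hm.const_sub c).const_mul M)).div
        (((Real.continuous_exp.tendsto _).comp (hinv.const_mul 2)).mul_const c) (by positivity)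
    rw [sub_self, mul_zero, mul_zero, Real.exp_zero, one_mul, sub_zero, sub_zero,
      mul_div_cancel_right₀ _ hc0.ne'] at hlim
    obtain ⟨R, hRa, hR⟩ := ((hlim.eventually_const_lt ha).and (eventually_gt_atTop 0)).exists
    have hsh : Tendsto (fun u : ℝ ↦ u - R⁻¹) atTop atTop := by
      exact tendsto_atTop_add_const_right _ (-R⁻¹) tendsto_id
    have hlt : A * c - R⁻¹ < A * c := by have := inv_pos.mpr hR; linarith
    filter_upwards [((hI (l := R ^ 2) (by positivity)).comp hsh).eventually_const_lt hlt] with u hu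
    have h := integral_mul_fejer_le hB hB0 hBM hmono (l := R ^ 2) (by positivity)
      (inv_pos.mpr hR) u
    rw [hscale hR] at h
    refine hRa.trans_le ?_
    rw [div_le_iff₀ (by positivity)]
    simp only [Function.comp_apply] at hu
    linarith
  · intro a ha
    have hlim : Tendsto (fun R : ℝ ↦ (A * c + R⁻¹) /
        (Real.exp (-(2 * R⁻¹)) * ∫ v in (-R)..R, fejer 1 v)) atTop
        (𝓝 ((A * c + 0) / (Real.exp (-(2 * 0)) * c))) :=
      (hinv.const_add _).div
        (((Real.continuous_exp.tendsto _).comp (hinv.const_mul 2).neg).mul hm) (by positivity)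
    rw [mul_zero, neg_zero, Real.exp_zero, one_mul, add_zero,
      mul_div_cancel_right₀ _ hc0.ne'] at hlim
    obtain ⟨R, ⟨hRa, hR⟩, hRm⟩ := (((hlim.eventually_lt_const ha).and
      (eventually_gt_atTop 0)).and (hm.eventually_const_lt hc0)).exists
    have hsh : Tendsto (fun u : ℝ ↦ u + R⁻¹) atTop atTop :=
      tendsto_atTop_add_const_right _ _ tendsto_id
    have hlt : A * c < A * c + R⁻¹ := by have := inv_pos.mpr hR; linarith
    filter_upwards [((hI (l := R ^ 2) (by positivity)).comp hsh).eventually_lt_const hlt,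
      eventually_ge_atTop 0] with u hu hu0
    have h := mul_integral_fejer_le hB hB0 hBM hmono (l := R ^ 2) (by positivity)
      (inv_pos.mpr hR) hu0
    rw [hscale hR, mul_assoc] at h
    refine lt_of_le_of_lt ?_ hRa
    rw [le_div_iff₀ (by positivity)]
    simp only [Function.comp_apply] at hu
    linarith

end Tauberian

end WienerIkehara

/-! ### The prime number theorem in arithmetic progressions -/

namespace PrimesMod

open MeasureTheory Filter Topology Set ArithmeticFunction.vonMangoldt

variable {q : ℕ} (a : ZMod q)

/-- The second Chebyshev function of the residue class `a`. -/
noncomputable def psiMod (x : ℝ) : ℝ := ∑ n ∈ Finset.Icc 1 ⌊x⌋₊, residueClass a n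

lemma psiMod_nonneg (x : ℝ) : 0 ≤ psiMod a x :=
  Finset.sum_nonneg fun n _ ↦ residueClass_nonneg a n

lemma psiMod_mono : Monotone (psiMod a) := fun _ _ hxy ↦
  Finset.sum_le_sum_of_subset_of_nonneg
    (Finset.Icc_subset_Icc_right (Nat.floor_le_floor hxy)) fun n _ _ ↦ residueClass_nonneg a n

lemma psiMod_le {x : ℝ} (hx : 0 ≤ x) : psiMod a x ≤ (Real.log 4 + 4) * x :=
  (Finset.sum_le_sum fun n _ ↦ residueClass_le a n).trans (Chebyshev.psi_le_const_mul_self hx)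

/-- Partial summation writes the series as a Mellin transform of `psiMod`, and `x = exp t` turns it
into a Laplace transform. -/
lemma LSeries_residueClass_eq_mul_integral {s : ℂ} (hs : 0 < s.re) :
    LSeries (fun n ↦ (residueClass a n : ℂ)) (1 + s) =
      (1 + s) * ∫ t in Ioi (0 : ℝ),
        ((Real.exp (-t) * psiMod a (Real.exp t) : ℝ) : ℂ) * Complex.exp (-s * t) := by
  have hO : (fun n : ℕ ↦ ∑ k ∈ Finset.Icc 1 n, residueClass a k) =O[atTop]
      fun n : ℕ ↦ (n : ℝ) ^ (1 : ℝ) := by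
    refine Asymptotics.IsBigO.of_bound (Real.log 4 + 4) (.of_forall fun n ↦ ?_)
    have h0 := psiMod_nonneg a n
    have h1 := psiMod_le a n.cast_nonneg
    rw [psiMod, Nat.floor_natCast] at h0 h1
    simpa [abs_of_nonneg h0] using h1
  rw [LSeries_eq_mul_integral_of_nonneg _ zero_le_one (by simpa using hs) hO
    (residueClass_nonneg a)]
  congr 1
  have himg : Real.exp '' Ioi 0 = Ioi 1 := by
    ext x
    simp only [mem_image, mem_Ioi]
    refine ⟨?_, fun hx ↦ ⟨Real.log x, Real.log_pos hx, Real.exp_log (by linarith)⟩⟩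
    rintro ⟨t, ht, rfl⟩
    exact Real.one_lt_exp_iff.mpr ht
  rw [← himg, integral_image_eq_integral_abs_deriv_smul measurableSet_Ioi
    (fun x _ ↦ (Real.hasDerivAt_exp x).hasDerivWithinAt) Real.exp_injective.injOn]
  refine integral_congr_ae (.of_forall fun t ↦ ?_)
  simp only [psiMod, abs_of_pos (Real.exp_pos t), Complex.real_smul]
  rw [Complex.cpow_def_of_ne_zero (by simp [Complex.exp_ne_zero]), ← Complex.ofReal_log
    (Real.exp_pos t).le, Real.log_exp]
  push_cast
  rw [mul_comm (Complex.exp (-(t : ℂ))), mul_assoc, ← Complex.exp_add, mul_left_comm,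
    ← Complex.exp_add]
  ring_nf

variable {a}

/-- The prime number theorem for the residue class `a`, in terms of the von Mangoldt function. -/
theorem tendsto_psiMod_div [NeZero q] (ha : IsUnit a) :
    Tendsto (fun x ↦ psiMod a x / x) atTop (𝓝 (q.totient : ℝ)⁻¹) := by
  set A : ℝ := (q.totient : ℝ)⁻¹ with hA
  set B : ℝ → ℝ := fun t ↦ Real.exp (-t) * psiMod a (Real.exp t) with hBdef
  have hB : Measurable B :=
    (by fun_prop : Measurable fun t ↦ Real.exp (-t)).mul
      ((psiMod_mono a).measurable.comp Real.measurable_exp)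
  have hB0 (t : ℝ) : 0 ≤ B t := mul_nonneg (Real.exp_pos _).le (psiMod_nonneg a _)
  have hBM (t : ℝ) : B t ≤ Real.log 4 + 4 := by
    have := psiMod_le a (Real.exp_pos t).le
    simp only [hBdef, Real.exp_neg]
    rw [inv_mul_le_iff₀ (Real.exp_pos t), mul_comm]
    exact this
  have hBe (t : ℝ) : B t * Real.exp t = psiMod a (Real.exp t) := by
    simp only [hBdef, Real.exp_neg]
    field_simp
  have hlim : Tendsto B atTop (𝓝 A) := by
    -- The transform of `B` is `L(1 + s) / (1 + s)` and that of `A` is `A / s`. Their difference is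
    -- `(L(1 + s) - A / s - A) / (1 + s)`, and the auxiliary function at `1 + s` is `L(1 + s) - A /
    -- s`, continuous up to `Re s = 0`.
    refine WienerIkehara.tendsto_of_continuousOn_laplace
      (G := fun s ↦ (LFunctionResidueClassAux a (1 + s) - A) / (1 + s)) hB hB0 hBM
      (fun u t hut ↦ ?_) ?_ fun s hs ↦ ?_
    · rw [hBe, hBe]
      exact psiMod_mono a (Real.exp_le_exp.mpr hut)
    · refine ContinuousOn.div (ContinuousOn.sub ?_ continuousOn_const) (by fun_prop) ?_
      · exact (continuousOn_LFunctionResidueClassAux a).comp (by fun_prop) fun s hs ↦ by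
          simpa using hs
      · intro s hs h
        have := congrArg Complex.re h
        simp only [Complex.add_re, Complex.one_re, Complex.zero_re] at this
        have : 0 ≤ s.re := hs
        linarith
    · have hs0 : s ≠ 0 := by rintro rfl; simp at hs
      have hs1 : 1 + s ≠ 0 := fun h ↦ by
        have := congrArg Complex.re h
        simp only [Complex.add_re, Complex.one_re, Complex.zero_re] at this
        linarith
      have hI : IntegrableOn (fun t : ℝ ↦ Complex.exp (-s * t)) (Ioi 0) :=
        integrableOn_exp_mul_complex_Ioi (by simpa using hs) 0
      have hBI : IntegrableOn (fun t : ℝ ↦ (B t : ℂ) * Complex.exp (-s * t)) (Ioi 0) := by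
        refine (hI.norm.const_mul (Real.log 4 + 4)).mono'
          (Measurable.aestronglyMeasurable (by fun_prop)) (.of_forall fun t ↦ ?_)
        rw [norm_mul, Complex.norm_real, Real.norm_of_nonneg (hB0 t)]
        gcongr
        exact hBM t
      have h1 := eqOn_LFunctionResidueClassAux ha (x := 1 + s) (by simpa using hs)
      have h2 := LSeries_residueClass_eq_mul_integral a hs
      have h3 : ∫ t in Ioi (0 : ℝ), Complex.exp (-s * t) = 1 / s := by
        rw [integral_exp_mul_complex_Ioi (by simpa using hs)]
        simp
      simp only [Complex.ofReal_sub, sub_mul]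
      rw [integral_sub hBI (hI.const_mul _), integral_const_mul, h3, h1]
      simp only
      rw [h2, hA, add_sub_cancel_left, Complex.ofReal_inv, Complex.ofReal_natCast]
      change ((1 + s) * (∫ t in Ioi (0 : ℝ), (B t : ℂ) * Complex.exp (-s * t)) - _ - _) / _ = _
      generalize (∫ t in Ioi (0 : ℝ), (B t : ℂ) * Complex.exp (-s * t)) = J
      generalize (q.totient : ℂ)⁻¹ = c
      field_simp
      ring
  refine (hlim.comp Real.tendsto_log_atTop).congr' ?_
  filter_upwards [eventually_gt_atTop 0] with x hx
  simp only [hBdef, Function.comp_apply, Real.exp_neg, Real.exp_log hx]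
  field_simp

/-! ### From the von Mangoldt sum to the number of primes -/

variable (a)

/-- The primes up to `x` in the residue class `a`. -/
noncomputable def primesMod (x : ℝ) : Finset ℕ := {p ∈ Nat.primesLE ⌊x⌋₊ | ((p : ℕ) : ZMod q) = a}

/-- The first Chebyshev function of the residue class `a`. -/
noncomputable def thetaMod (x : ℝ) : ℝ := ∑ p ∈ primesMod a x, Real.log p

lemma primesLE_eq_filter_Ioc (n : ℕ) : Nat.primesLE n = {p ∈ Finset.Ioc 0 n | p.Prime} := by
  ext p
  simp only [Nat.mem_primesLE, Finset.mem_filter, Finset.mem_Ioc]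
  exact ⟨fun h ↦ ⟨⟨h.2.pos, h.1⟩, h.2⟩, fun h ↦ ⟨h.1.2, h.2⟩⟩

lemma thetaMod_eq_sum_residueClass (x : ℝ) :
    thetaMod a x = ∑ p ∈ Finset.Ioc 0 ⌊x⌋₊ with p.Prime, residueClass a p := by
  rw [thetaMod, primesMod, Finset.sum_filter, primesLE_eq_filter_Ioc]
  refine Finset.sum_congr rfl fun p hp ↦ ?_
  simp only [Set.indicator, mem_ofPred_eq]
  rw [ArithmeticFunction.vonMangoldt_apply_prime (Finset.mem_filter.mp hp).2]
  congr

lemma psiMod_sub_thetaMod (x : ℝ) :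
    psiMod a x - thetaMod a x = ∑ n ∈ Finset.Ioc 0 ⌊x⌋₊ with ¬n.Prime, residueClass a n := by
  rw [thetaMod_eq_sum_residueClass, sub_eq_iff_eq_add', psiMod]
  exact (Finset.sum_filter_add_sum_filter_not _ _ _).symm

lemma thetaMod_le_psiMod (x : ℝ) : thetaMod a x ≤ psiMod a x := by
  rw [← sub_nonneg, psiMod_sub_thetaMod]
  exact Finset.sum_nonneg fun n _ ↦ residueClass_nonneg a n

/-- Restricting to a residue class only drops nonnegative terms, so the bound on proper prime powers
without congruence condition suffices. -/
lemma psiMod_sub_thetaMod_le {x : ℝ} (hx : 1 ≤ x) :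
    psiMod a x - thetaMod a x ≤ 2 * √x * Real.log x := by
  refine le_trans ?_ (Chebyshev.psi_sub_theta_le hx)
  rw [psiMod_sub_thetaMod, Chebyshev.psi_sub_theta_eq_sum_not_prime]
  exact Finset.sum_le_sum fun n _ ↦ residueClass_le a n

lemma thetaMod_le_card_mul_log {x : ℝ} :
    thetaMod a x ≤ (primesMod a x).card * Real.log x := by
  rw [← nsmul_eq_mul]
  refine Finset.sum_le_card_nsmul _ _ _ fun p hp ↦ ?_
  have hp' := Nat.mem_primesLE.mp (Finset.mem_filter.mp hp).1
  exact Real.log_le_log (mod_cast hp'.2.pos) ((Nat.le_floor_iff' hp'.2.ne_zero).mp hp'.1)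

/-- Both sides are sums of `log x - log p ≥ 0`, over the class and over all primes, so an error
bound for all primes serves for the class. -/
lemma card_mul_log_sub_thetaMod_le {x : ℝ} :
    (primesMod a x).card * Real.log x - thetaMod a x ≤
      (Nat.primeCounting ⌊x⌋₊) * Real.log x - Chebyshev.theta x := by
  have h1 : Chebyshev.theta x = ∑ p ∈ Nat.primesLE ⌊x⌋₊, Real.log p := by
    rw [primesLE_eq_filter_Ioc, Chebyshev.theta]
  have h2 : (Nat.primeCounting ⌊x⌋₊ : ℝ) * Real.log x =
      ∑ p ∈ Nat.primesLE ⌊x⌋₊, Real.log x := by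
    simp
  have h3 : ((primesMod a x).card : ℝ) * Real.log x = ∑ p ∈ primesMod a x, Real.log x := by
    simp
  rw [h1, h2, h3, thetaMod, ← Finset.sum_sub_distrib, ← Finset.sum_sub_distrib]
  refine Finset.sum_le_sum_of_subset_of_nonneg (Finset.filter_subset _ _) fun p hp _ ↦ ?_
  have hp' := Nat.mem_primesLE.mp hp
  exact sub_nonneg.mpr
    (Real.log_le_log (mod_cast hp'.2.pos) ((Nat.le_floor_iff' hp'.2.ne_zero).mp hp'.1))

variable {a}

lemma tendsto_sqrt_mul_log_div : Tendsto (fun x : ℝ ↦ 2 * √x * Real.log x / x) atTop (𝓝 0) := by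
  have h := (isLittleO_log_rpow_atTop (r := 1 / 2) (by norm_num)).tendsto_div_nhds_zero.const_mul 2
  rw [mul_zero] at h
  refine h.congr' ?_
  filter_upwards [eventually_gt_atTop 0] with x hx
  rw [← Real.sqrt_eq_rpow]
  have := Real.sqrt_pos.mpr hx
  field_simp
  rw [Real.sq_sqrt hx.le]

lemma tendsto_thetaMod_div [NeZero q] (ha : IsUnit a) :
    Tendsto (fun x ↦ thetaMod a x / x) atTop (𝓝 (q.totient : ℝ)⁻¹) := by
  refine tendsto_of_tendsto_of_tendsto_of_le_of_le'
    (by simpa using (tendsto_psiMod_div ha).sub tendsto_sqrt_mul_log_div)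
    (tendsto_psiMod_div ha) ?_ ?_
  · filter_upwards [eventually_ge_atTop 1] with x hx
    rw [← sub_div]
    gcongr
    linarith [psiMod_sub_thetaMod_le a hx]
  · filter_upwards [eventually_ge_atTop 1] with x hx
    gcongr
    exact thetaMod_le_psiMod a x

/-- The **prime number theorem in arithmetic progressions**. -/
theorem tendsto_card_primesMod [NeZero q] (ha : IsUnit a) :
    Tendsto (fun x ↦ (primesMod a x).card * Real.log x / x) atTop (𝓝 (q.totient : ℝ)⁻¹) := by
  have hlog : Tendsto (fun x : ℝ ↦ (Real.log x)⁻¹) atTop (𝓝 0) :=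
    tendsto_inv_atTop_zero.comp Real.tendsto_log_atTop
  have herr : Tendsto (fun x : ℝ ↦
      ((Nat.primeCounting ⌊x⌋₊) * Real.log x - Chebyshev.theta x) / x) atTop (𝓝 0) := by
    refine Asymptotics.IsBigO.trans_tendsto ?_ hlog
    have h := Chebyshev.primeCounting_sub_theta_div_log_isBigO.mul
      (Asymptotics.isBigO_refl (fun x : ℝ ↦ Real.log x / x) atTop)
    refine h.congr' ?_ ?_
    · filter_upwards [eventually_gt_atTop 1] with x hx
      have := Real.log_pos hx
      field_simp
    · filter_upwards [eventually_gt_atTop 1] with x hx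
      have := Real.log_pos hx
      field_simp
  refine tendsto_of_tendsto_of_tendsto_of_le_of_le' (tendsto_thetaMod_div ha)
    (by simpa using (tendsto_thetaMod_div ha).add herr) ?_ ?_
  · filter_upwards [eventually_ge_atTop 1] with x hx
    gcongr
    exact thetaMod_le_card_mul_log a
  · filter_upwards [eventually_ge_atTop 1] with x hx
    rw [← add_div]
    gcongr
    linarith [card_mul_log_sub_thetaMod_le a (x := x)]

end PrimesMod

/-! ### Multiplicative functions with prescribed values on prime powers -/

namespace MultiplicativeSum

open Filter Topology ArithmeticFunction
open scoped ArithmeticFunction.zeta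

/-- The multiplicative function with value `c p k` at `p ^ k`, for `p` prime and `k` positive. -/
noncomputable def ofLocal (c : ℕ → ℕ → ℝ) : ArithmeticFunction ℝ where
  toFun n := if n = 0 then 0 else ∏ p ∈ n.primeFactors, c p (n.factorization p)
  map_zero' := if_pos rfl

lemma ofLocal_apply (c : ℕ → ℕ → ℝ) {n : ℕ} (hn : n ≠ 0) :
    ofLocal c n = ∏ p ∈ n.primeFactors, c p (n.factorization p) := if_neg hn

lemma ofLocal_prime_pow (c : ℕ → ℕ → ℝ) {p : ℕ} (hp : p.Prime) (k : ℕ) :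
    ofLocal c (p ^ (k + 1)) = c p (k + 1) := by
  rw [ofLocal_apply c (pow_ne_zero _ hp.ne_zero), Nat.primeFactors_prime_pow k.succ_ne_zero hp,
    Finset.prod_singleton, hp.factorization_pow, Finsupp.single_eq_same]

lemma isMultiplicative_ofLocal (c : ℕ → ℕ → ℝ) : (ofLocal c).IsMultiplicative := by
  refine IsMultiplicative.iff_ne_zero.mpr ⟨by simp [ofLocal_apply], fun {m n} hm hn hmn ↦ ?_⟩
  rw [ofLocal_apply c (mul_ne_zero hm hn), ofLocal_apply c hm, ofLocal_apply c hn,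
    hmn.primeFactors_mul, Finset.prod_union hmn.disjoint_primeFactors]
  refine congrArg₂ _ (Finset.prod_congr rfl fun p hp ↦ ?_) (Finset.prod_congr rfl fun p hp ↦ ?_)
  · rw [Nat.factorization_eq_of_coprime_left hmn (by simpa using hp)]
  · rw [Nat.factorization_eq_of_coprime_right hmn (by simpa using hp)]

/-- Convolution with a completely multiplicative function, seen on prime powers. -/
lemma mul_apply_prime_pow_succ {f g : ArithmeticFunction ℝ} {p : ℕ} (hp : p.Prime)
    (hg1 : g 1 = 1) (hg : ∀ k, g (p ^ (k + 1)) = g p * g (p ^ k)) (k : ℕ) :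
    (f * g) (p ^ (k + 1)) = f (p ^ (k + 1)) + g p * (f * g) (p ^ k) := by
  have h (k : ℕ) : (f * g) (p ^ k) = ∑ i ∈ Finset.range (k + 1), f (p ^ i) * g (p ^ (k - i)) := by
    rw [mul_apply, Nat.sum_divisorsAntidiagonal (f := fun a b ↦ f a * g b),
      Nat.sum_divisors_prime_pow hp]
    refine Finset.sum_congr rfl fun i hi ↦ ?_
    rw [Nat.pow_div (Nat.lt_succ_iff.mp (Finset.mem_range.mp hi)) hp.pos]
  rw [h, h, Finset.sum_range_succ, Nat.sub_self, pow_zero, hg1, mul_one, add_comm, Finset.mul_sum]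
  congr 1
  refine Finset.sum_congr rfl fun i hi ↦ ?_
  rw [Nat.sub_add_comm (Nat.lt_succ_iff.mp (Finset.mem_range.mp hi)), hg]
  ring

/-- The hypotheses compare coefficients in the identity of Euler factors `C_p(x) = (1 - g(p) x)
E_p(x)`. Degree one is separate because `e p 0` is not required to be 1. -/
lemma ofLocal_mul_eq {c e : ℕ → ℕ → ℝ} {g : ArithmeticFunction ℝ} (hgm : g.IsMultiplicative)
    (hg : ∀ p k, p.Prime → g (p ^ (k + 1)) = g p * g (p ^ k))
    (h1 : ∀ p, p.Prime → e p 1 = c p 1 + g p)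
    (h2 : ∀ p k, p.Prime → 1 ≤ k → e p (k + 1) = c p (k + 1) + g p * e p k) :
    ofLocal c * g = ofLocal e := by
  rw [((isMultiplicative_ofLocal c).mul hgm).eq_iff_eq_on_prime_powers _ _
    (isMultiplicative_ofLocal e)]
  intro p k hp
  have hg1 := hgm.map_one
  induction k with
  | zero => simp [hg1, (isMultiplicative_ofLocal _).map_one]
  | succ k ih =>
    rw [mul_apply_prime_pow_succ hp hg1 (fun k ↦ hg p k hp), ih, ofLocal_prime_pow c hp,
      ofLocal_prime_pow e hp]
    rcases k with _ | k
    · rw [h1 p hp, pow_zero, (isMultiplicative_ofLocal e).map_one, mul_one]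
    · rw [ofLocal_prime_pow e hp, h2 p _ hp k.succ_pos]

/-! ### Sums of multiplicative functions over all natural numbers -/

/-- A finite set of positive integers consists of `N`-smooth numbers for some `N`, and the finite
Euler product over primes below `N` is at most `∏ (1 + e p) ≤ exp (∑ e n)`. -/
lemma summable_of_multiplicative {f : ℕ → ℝ} (hf : ∀ n, 0 ≤ f n) (h0 : f 0 = 0) (h1 : f 1 = 1)
    (hmul : ∀ {m n}, Nat.Coprime m n → f (m * n) = f m * f n)
    (hsum : ∀ {p : ℕ}, p.Prime → Summable fun k ↦ f (p ^ k)) {e : ℕ → ℝ} (he : Summable e)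
    (he0 : ∀ n, 0 ≤ e n) (hle : ∀ p : ℕ, p.Prime → ∑' k, f (p ^ k) ≤ 1 + e p) :
    Summable f := by
  refine summable_of_sum_le (c := Real.exp (∑' n, e n)) hf fun S ↦ ?_
  obtain ⟨N, hN⟩ := S.exists_nat_subset_range
  obtain ⟨hs1, hs2⟩ := EulerProduct.summable_and_hasSum_smoothNumbers_prod_primesBelow_tsum h1 hmul
    (fun hp ↦ by simpa [abs_of_nonneg (hf _)] using hsum hp) N
  have hs1' : Summable fun m : N.smoothNumbers ↦ f m := by
    simpa [abs_of_nonneg (hf _)] using hs1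
  have hind : Summable ((N.smoothNumbers).indicator f) := summable_subtype_iff_indicator.mp hs1'
  calc ∑ n ∈ S, f n ≤ ∑ n ∈ S, (N.smoothNumbers).indicator f n := by
        refine Finset.sum_le_sum fun n hn ↦ ?_
        rcases eq_or_ne n 0 with rfl | hn0
        · rw [h0]
          exact Set.indicator_nonneg (fun n _ ↦ hf n) _
        · rw [Set.indicator_of_mem]
          exact Nat.mem_smoothNumbers_of_lt (Nat.pos_of_ne_zero hn0)
            (Finset.mem_range.mp (hN hn))
    _ ≤ ∑' n, (N.smoothNumbers).indicator f n :=
        hind.sum_le_tsum _ fun n _ ↦ Set.indicator_nonneg (fun n _ ↦ hf n) _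
    _ = ∏ p ∈ N.primesBelow, ∑' k, f (p ^ k) := by
        rw [← tsum_subtype, hs2.tsum_eq]
    _ ≤ ∏ p ∈ N.primesBelow, (1 + e p) :=
        Finset.prod_le_prod (fun p _ ↦ tsum_nonneg fun k ↦ hf _)
          fun p hp ↦ hle p (Nat.prime_of_mem_primesBelow hp)
    _ ≤ Real.exp (∑ p ∈ N.primesBelow, e p) := Real.prod_one_add_le_exp_sum _ he0
    _ ≤ Real.exp (∑' n, e n) := Real.exp_le_exp.mpr (he.sum_le_tsum _ fun n _ ↦ he0 n)

/-- The terms may have either sign; positivity comes from writing the Euler product as the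
exponential of a convergent sum of logarithms. -/
lemma tsum_pos_of_multiplicative {f : ℕ → ℝ} (h0 : f 0 = 0) (h1 : f 1 = 1)
    (hmul : ∀ {m n}, Nat.Coprime m n → f (m * n) = f m * f n) (hf : Summable (‖f ·‖))
    (hpos : ∀ p : Nat.Primes, 0 < ∑' k, f (p ^ k))
    (hsum : Summable fun p : Nat.Primes ↦ (∑' k, f (p ^ k)) - 1) :
    0 < ∑' n, f n := by
  have hlog := Real.summable_log_one_add_of_summable hsum
  simp only [add_sub_cancel] at hlog
  rw [← (EulerProduct.eulerProduct_hasProd h1 hmul hf h0).tprod_eq,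
    ← Real.rexp_tsum_eq_tprod hpos hlog]
  exact Real.exp_pos _

/-- If `∑ n ≤ N, g n ~ L N` and `∑ |f n| / n` converges, then
`∑ n ≤ N, (f * g) n ~ L (∑ f n / n) N`. -/
theorem tendsto_sum_mul_div {f g : ArithmeticFunction ℝ} {L : ℝ}
    (hg : Tendsto (fun N : ℕ ↦ (∑ n ∈ Finset.Ioc 0 N, g n) / N) atTop (𝓝 L))
    (hf : Summable fun n : ℕ ↦ ‖f n / n‖) :
    Tendsto (fun N : ℕ ↦ (∑ n ∈ Finset.Ioc 0 N, (f * g) n) / N) atTop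
      (𝓝 ((∑' n : ℕ, f n / n) * L)) := by
  set G : ℕ → ℝ := fun N ↦ ∑ n ∈ Finset.Ioc 0 N, g n with hG
  obtain ⟨C, hC⟩ := hg.norm.bddAbove_range
  have hC' (N : ℕ) : ‖G N‖ ≤ C * N := by
    rcases eq_or_ne N 0 with rfl | hN
    · simp [hG]
    · have := hC ⟨N, rfl⟩
      simp only [norm_div, RCLike.norm_natCast] at this
      rwa [div_le_iff₀ (by positivity)] at this
  have hC0 : 0 ≤ C := by simpa using (norm_nonneg _).trans (hC' 1)
  have hterm (N : ℕ) : (∑ n ∈ Finset.Ioc 0 N, (f * g) n) / N =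
      ∑' d : ℕ, f d / d * (d * G (N / d) / N) := by
    rw [sum_Ioc_mul_eq_sum_sum, tsum_eq_sum (s := Finset.Ioc 0 N), Finset.sum_div]
    · refine Finset.sum_congr rfl fun d hd ↦ ?_
      have : (d : ℝ) ≠ 0 := by
        have := (Finset.mem_Ioc.mp hd).1
        positivity
      field_simp
      rfl
    · intro d hd
      rcases eq_or_ne d 0 with rfl | hd0
      · simp
      · rw [Finset.mem_Ioc, not_and, not_le] at hd
        rw [Nat.div_eq_of_lt (hd (Nat.pos_of_ne_zero hd0))]
        simp [hG]
  simp_rw [hterm]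
  rw [← tsum_mul_right]
  -- For fixed `d` the factor `d * G (N / d) / N` tends to `L`, and `‖G n‖ ≤ C * n` bounds it by `C`
  -- uniformly in `N`.
  refine tendsto_tsum_of_dominated_convergence (bound := fun d ↦ ‖f d / d‖ * C)
    (hf.mul_right C) (fun d ↦ ?_) (.of_forall fun N d ↦ ?_)
  · rcases eq_or_ne d 0 with rfl | hd
    · simp
    · refine Tendsto.const_mul _ ?_
      have hdiv : Tendsto (fun N : ℕ ↦ N / d) atTop atTop :=
        Nat.tendsto_div_const_atTop hd
      have h1 := hg.comp hdiv
      have h2 : Tendsto (fun N : ℕ ↦ (d : ℝ) * (N / d : ℕ) / N) atTop (𝓝 1) := by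
        have h3 := (tendsto_nat_floor_mul_div_atTop (R := ℝ) (a := (d : ℝ)⁻¹)
          (by positivity)).comp tendsto_natCast_atTop_atTop
        have h4 := h3.const_mul (d : ℝ)
        rw [mul_inv_cancel₀ (by positivity)] at h4
        refine h4.congr fun N ↦ ?_
        simp only [Function.comp_apply]
        rw [inv_mul_eq_div, Nat.floor_div_eq_div]
        ring
      rw [← mul_one L]
      refine (h1.mul h2).congr' ?_
      filter_upwards [hdiv.eventually_gt_atTop 0] with N hN
      simp only [Function.comp_apply]
      have : ((N / d : ℕ) : ℝ) ≠ 0 := by positivity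
      field_simp
      rfl
  · rw [norm_mul]
    refine mul_le_mul_of_nonneg_left ?_ (norm_nonneg _)
    rcases eq_or_ne N 0 with rfl | hN
    · simpa using hC0
    rw [norm_div, norm_mul, RCLike.norm_natCast, RCLike.norm_natCast, div_le_iff₀ (by positivity)]
    calc (d : ℝ) * ‖G (N / d)‖ ≤ d * (C * (N / d : ℕ)) := by gcongr; exact hC' _
      _ = C * ((d * (N / d) : ℕ) : ℝ) := by push_cast; ring
      _ ≤ C * N := by gcongr; exact Nat.mul_div_le N d

end MultiplicativeSum

/-! ### Sums of two squares on average -/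

namespace MultiplicativeSum

open Filter Topology ArithmeticFunction
open scoped ArithmeticFunction.zeta

/-- The quadratic character mod `4` as an arithmetic function. -/
noncomputable def chiFour : ArithmeticFunction ℝ where
  toFun n := (ZMod.χ₄ n : ℝ)
  map_zero' := by simp

lemma chiFour_apply (n : ℕ) : chiFour n = (ZMod.χ₄ n : ℝ) := rfl

lemma chiFour_mul (m n : ℕ) : chiFour (m * n) = chiFour m * chiFour n := by
  rw [chiFour_apply, chiFour_apply, chiFour_apply, Nat.cast_mul, map_mul, Int.cast_mul]

lemma isMultiplicative_chiFour : chiFour.IsMultiplicative :=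
  ⟨by simp [chiFour_apply], fun _ ↦ chiFour_mul _ _⟩

lemma chiFour_of_mod_four_eq_one {n : ℕ} (hn : n % 4 = 1) : chiFour n = 1 := by
  simp [chiFour_apply, ZMod.χ₄_nat_one_mod_four hn]

lemma chiFour_of_mod_four_eq_three {n : ℕ} (hn : n % 4 = 3) : chiFour n = -1 := by
  simp [chiFour_apply, ZMod.χ₄_nat_three_mod_four hn]

lemma chiFour_of_even {n : ℕ} (hn : n % 2 = 0) : chiFour n = 0 := by
  rw [chiFour_apply, ZMod.χ₄_nat_eq_if_mod_four, if_pos hn, Int.cast_zero]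

lemma abs_chiFour_le (n : ℕ) : |chiFour n| ≤ 1 := by
  rw [chiFour_apply, ZMod.χ₄_nat_eq_if_mod_four]
  split_ifs <;> simp

lemma sum_chiFour (N : ℕ) :
    ∑ n ∈ Finset.Ioc 0 N, chiFour n = if N % 4 = 1 ∨ N % 4 = 2 then 1 else 0 := by
  induction N with
  | zero => simp
  | succ N ih =>
    rw [Finset.sum_Ioc_succ_top N.zero_le, ih, chiFour_apply, ZMod.χ₄_nat_eq_if_mod_four]
    have h4 : N % 4 = 0 ∨ N % 4 = 1 ∨ N % 4 = 2 ∨ N % 4 = 3 := by omega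
    rcases h4 with h | h | h | h
    · have h1 : (N + 1) % 4 = 1 := by omega
      have h2 : (N + 1) % 2 = 1 := by omega
      simp [h, h1, h2]
    · have h1 : (N + 1) % 4 = 2 := by omega
      have h2 : (N + 1) % 2 = 0 := by omega
      simp [h, h1, h2]
    · have h1 : (N + 1) % 4 = 3 := by omega
      have h2 : (N + 1) % 2 = 1 := by omega
      simp [h, h1, h2]
    · have h1 : (N + 1) % 4 = 0 := by omega
      have h2 : (N + 1) % 2 = 0 := by omega
      simp [h, h1, h2]

lemma abs_sum_chiFour_mul_le {g : ℕ → ℝ} {D : ℕ} (hg : ∀ n, D ≤ n → g (n + 1) ≤ g n)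
    (hg0 : ∀ n, 0 ≤ g n) {N : ℕ} (hN : D ≤ N) :
    |∑ n ∈ Finset.Ioc D N, chiFour n * g n| ≤ g D := by
  set s : ℕ → ℝ := fun N ↦ ∑ n ∈ Finset.Ioc 0 N, chiFour n with hs
  have hs0 (N : ℕ) : 0 ≤ s N ∧ s N ≤ 1 := by
    rw [hs]
    simp only [sum_chiFour]
    split_ifs <;> simp
  -- Abel summation: the expression equals `∑ s n * (g n - g (n + 1))` over `D ≤ n < N`, with every
  -- `s n` in `[0, 1]`.
  have key : 0 ≤ (∑ n ∈ Finset.Ioc D N, chiFour n * g n) - s N * g N + s D * g D ∧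
      (∑ n ∈ Finset.Ioc D N, chiFour n * g n) - s N * g N + s D * g D ≤ g D - g N := by
    induction N, hN using Nat.le_induction with
    | base => simp
    | succ N hN ih =>
      have h1 : s (N + 1) = s N + chiFour (N + 1) := Finset.sum_Ioc_succ_top N.zero_le _
      rw [Finset.sum_Ioc_succ_top hN, h1]
      have h2 : 0 ≤ s N * (g N - g (N + 1)) :=
        mul_nonneg (hs0 N).1 (sub_nonneg.mpr (hg N hN))
      have h3 : s N * (g N - g (N + 1)) ≤ 1 * (g N - g (N + 1)) :=
        mul_le_mul_of_nonneg_right (hs0 N).2 (sub_nonneg.mpr (hg N hN))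
      constructor <;> nlinarith [ih.1, ih.2]
  have h1 : 0 ≤ s N * g N := mul_nonneg (hs0 N).1 (hg0 N)
  have h2 : s N * g N ≤ 1 * g N := mul_le_mul_of_nonneg_right (hs0 N).2 (hg0 N)
  have h3 : 0 ≤ s D * g D := mul_nonneg (hs0 D).1 (hg0 D)
  have h4 : s D * g D ≤ 1 * g D := mul_le_mul_of_nonneg_right (hs0 D).2 (hg0 D)
  rw [abs_le]
  constructor <;> linarith [key.1, key.2]

lemma sum_chiFour_div (N : ℕ) :
    ∑ n ∈ Finset.Ioc 0 N, chiFour n / n =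
      ∑ i ∈ Finset.range ((N + 1) / 2), (-1 : ℝ) ^ i / (2 * i + 1) := by
  induction N with
  | zero => simp
  | succ N ih =>
    rw [Finset.sum_Ioc_succ_top N.zero_le, ih]
    rcases Nat.even_or_odd' N with ⟨i, rfl | rfl⟩
    · rw [show (2 * i + 1 + 1) / 2 = i + 1 by omega, show (2 * i + 1) / 2 = i by omega,
        Finset.sum_range_succ, chiFour_apply, ZMod.χ₄_eq_neg_one_pow (by omega),
        show (2 * i + 1) / 2 = i by omega]
      push_cast
      rfl
    · rw [chiFour_of_even (by omega), zero_div, add_zero,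
        show (2 * i + 1 + 1 + 1) / 2 = (2 * i + 1 + 1) / 2 by omega]

lemma tendsto_sum_chiFour_div :
    Tendsto (fun N : ℕ ↦ ∑ n ∈ Finset.Ioc 0 N, chiFour n / n) atTop (𝓝 (Real.pi / 4)) := by
  simp_rw [sum_chiFour_div]
  exact Real.tendsto_sum_pi_div_four.comp
    ((Nat.tendsto_div_const_atTop two_ne_zero).comp (tendsto_add_atTop_nat 1))

/-- For `d ≤ D`, replacing `⌊N / d⌋` by `N / d` costs at most 1 per term, hence `D / N`. For `d > D`
the weights `⌊N / d⌋` decrease, so the oscillation of `χ₄` bounds the tail by `⌊N / D⌋`, hence `1 /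
D`. -/
lemma abs_sum_chiFour_mul_zeta_sub_le {N D : ℕ} (hD : 0 < D) (hDN : D ≤ N) :
    |(∑ n ∈ Finset.Ioc 0 N, (chiFour * (ζ : ArithmeticFunction ℝ)) n) / N -
      ∑ n ∈ Finset.Ioc 0 D, chiFour n / n| ≤ D / N + 1 / D := by
  have hN : (0 : ℝ) < N := by exact_mod_cast hD.trans_le hDN
  have hD' : (0 : ℝ) < D := by exact_mod_cast hD
  rw [sum_Ioc_mul_zeta_eq_sum, ← Finset.sum_Ioc_consecutive _ D.zero_le hDN, add_div,
    add_sub_right_comm]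
  refine (abs_add_le _ _).trans (add_le_add ?_ ?_)
  · rw [Finset.sum_div, ← Finset.sum_sub_distrib]
    refine (Finset.abs_sum_le_sum_abs _ _).trans ((Finset.sum_le_card_nsmul _ _ (1 / (N : ℝ))
      fun d hd ↦ ?_).trans (by simp [div_eq_mul_inv]))
    have hd0 : (0 : ℝ) < d := by exact_mod_cast (Finset.mem_Ioc.mp hd).1
    have h1 : ((N / d : ℕ) : ℝ) ≤ N / d := Nat.cast_div_le
    have h2 : (N : ℝ) / d < (N / d : ℕ) + 1 := by
      rw [← Nat.floor_div_eq_div (K := ℝ)]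
      exact Nat.lt_floor_add_one _
    have h3 : chiFour d * (N / d : ℕ) / N - chiFour d / d =
        chiFour d * (((N / d : ℕ) - (N : ℝ) / d) / N) := by
      field_simp
    rw [h3, abs_mul, abs_div, abs_of_pos hN]
    have h4 : |((N / d : ℕ) : ℝ) - (N : ℝ) / d| ≤ 1 := by
      rw [abs_le]; constructor <;> linarith
    calc _ ≤ 1 * (1 / (N : ℝ)) := by gcongr; exact abs_chiFour_le d
      _ = _ := one_mul _
  · rw [abs_div, abs_of_pos hN, div_le_div_iff₀ hN hD', one_mul]
    have h := abs_sum_chiFour_mul_le (g := fun n ↦ ((N / n : ℕ) : ℝ)) (D := D)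
      (fun n hn ↦ by
        have : 0 < n := hD.trans_le hn
        simp only [Nat.cast_le]
        gcongr
        omega) (fun n ↦ Nat.cast_nonneg _) hDN
    calc _ ≤ ((N / D : ℕ) : ℝ) * D := by gcongr
      _ ≤ N := by exact_mod_cast Nat.div_mul_le_self N D

/-- The mean value of the number of representations as a sum of two squares. -/
lemma tendsto_sum_chiFour_mul_zeta :
    Tendsto (fun N : ℕ ↦ (∑ n ∈ Finset.Ioc 0 N, (chiFour * (ζ : ArithmeticFunction ℝ)) n) / N)
      atTop (𝓝 (Real.pi / 4)) := by
  have hsqrt : Tendsto Nat.sqrt atTop atTop :=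
    tendsto_atTop_atTop.mpr fun b ↦ ⟨b * b, fun a ha ↦ Nat.le_sqrt.mpr ha⟩
  have hinv : Tendsto (fun N : ℕ ↦ 1 / (N.sqrt : ℝ)) atTop (𝓝 0) :=
    tendsto_one_div_atTop_nhds_zero_nat.comp hsqrt
  -- Cutting at `D = √N` sends both errors `D / N` and `1 / D` to 0.
  have herr : Tendsto (fun N : ℕ ↦
      (∑ n ∈ Finset.Ioc 0 N, (chiFour * (ζ : ArithmeticFunction ℝ)) n) / N -
      ∑ n ∈ Finset.Ioc 0 N.sqrt, chiFour n / n) atTop (𝓝 0) := by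
    refine squeeze_zero_norm' ?_ (by simpa using hinv.add hinv)
    filter_upwards [eventually_gt_atTop 0] with N hN
    have hD : 0 < N.sqrt := Nat.sqrt_pos.mpr hN
    refine (abs_sum_chiFour_mul_zeta_sub_le hD N.sqrt_le_self).trans ?_
    gcongr
    have : (0 : ℝ) < N.sqrt := by exact_mod_cast hD
    · rw [← one_div, div_le_div_iff₀ (by positivity) this, one_mul]
      exact_mod_cast N.sqrt_le
    · rw [one_div]
  simpa using herr.add (tendsto_sum_chiFour_div.comp hsqrt)

/-! ### Multiplicative functions supported on primes `≡ 1` mod `4` and a power of `2` -/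

/-- Local weights: `2` at primes `≡ 1` mod `4`, and `t` at `2 ^ 4`. -/
noncomputable def weight (t : ℝ) (p k : ℕ) : ℝ :=
  if p % 4 = 1 then (if k = 1 then 2 else 0)
  else if p = 2 then (if k = 4 then t else 0) else 0

/-- Local values of `weight t` divided by the quadratic character mod `4`. -/
noncomputable def weightDivChi (t : ℝ) (p k : ℕ) : ℝ :=
  if p % 4 = 1 then (if k = 1 then 1 else if k = 2 then -2 else 0)
  else if p = 2 then (if k = 4 then t else 0) else (if k = 1 then 1 else 0)

/-- Local values of `weight t` divided by the quadratic character mod `4` and by `ζ`. -/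
noncomputable def weightDiv (t : ℝ) (p k : ℕ) : ℝ :=
  if p % 4 = 1 then (if k = 2 then -3 else if k = 3 then 2 else 0)
  else if p = 2 then (if k = 1 then -1 else if k = 4 then t else if k = 5 then -t else 0)
  else (if k = 2 then -1 else 0)

lemma prime_mod_four {p : ℕ} (hp : p.Prime) :
    p % 4 = 1 ∨ p = 2 ∨ (p % 4 = 3 ∧ p ≠ 2) := by
  rcases hp.eq_two_or_odd with h | h
  · exact .inr (.inl h)
  · omega

/-- With `x` marking powers of `p`, dividing by `L(s, χ₄)` and then by `ζ(s)` changes the Euler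
factors as follows: `1 + 2x` to `1 + x - 2x²` to `1 - 3x² + 2x³` for `p ≡ 1`; `1` to `1 + x` to `1 -
x²` for `p ≡ 3`; and at 2, `1 + t x⁴` is only multiplied by `1 - x`, in the second division. -/
lemma ofLocal_weightDiv_mul_zeta (t : ℝ) :
    ofLocal (weightDiv t) * (ζ : ArithmeticFunction ℝ) = ofLocal (weightDivChi t) := by
  have hζ {p : ℕ} (hp : p.Prime) (k : ℕ) : (ζ : ArithmeticFunction ℝ) (p ^ k) = 1 := by
    simp [hp.ne_zero]
  refine ofLocal_mul_eq isMultiplicative_zeta.natCast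
    (fun p k hp ↦ ?_) (fun p hp ↦ ?_) fun p k hp hk ↦ ?_
  · have := hζ hp 1
    rw [pow_one] at this
    rw [hζ hp, hζ hp, this, one_mul]
  · have := hζ hp 1
    rw [pow_one] at this
    rw [this]
    rcases prime_mod_four hp with h | rfl | ⟨h, h2⟩
    · simp [weightDiv, weightDivChi, h]
    · simp [weightDiv, weightDivChi]
    · simp [weightDiv, weightDivChi, h, h2]
  · have := hζ hp 1
    rw [pow_one] at this
    rw [this, one_mul]
    have hk0 : k ≠ 0 := by omega
    rcases prime_mod_four hp with h | rfl | ⟨h, h2⟩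
    · obtain rfl | rfl | hk3 : k = 1 ∨ k = 2 ∨ 3 ≤ k := by omega
      · norm_num [weightDiv, weightDivChi, h]
      · norm_num [weightDiv, weightDivChi, h]
      · have h1 : k ≠ 1 := by omega
        have h2 : k ≠ 2 := by omega
        simp [weightDiv, weightDivChi, h, h1, h2, hk0]
    · obtain rfl | rfl | ⟨h3, h4⟩ : k = 3 ∨ k = 4 ∨ (k ≠ 3 ∧ k ≠ 4) := by omega
      · norm_num [weightDiv, weightDivChi]
      · norm_num [weightDiv, weightDivChi]
      · simp [weightDiv, weightDivChi, h3, h4, hk0]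
    · obtain rfl | hk3 : k = 1 ∨ k ≠ 1 := by omega
      · norm_num [weightDiv, weightDivChi, h, h2]
      · simp [weightDiv, weightDivChi, h, h2, hk3, hk0]

lemma ofLocal_weightDivChi_mul_chiFour (t : ℝ) :
    ofLocal (weightDivChi t) * chiFour = ofLocal (weight t) := by
  refine ofLocal_mul_eq isMultiplicative_chiFour
    (fun p k hp ↦ by rw [pow_succ', chiFour_mul]) (fun p hp ↦ ?_) fun p k hp hk ↦ ?_
  · rcases prime_mod_four hp with h | rfl | ⟨h, h2⟩
    · norm_num [weight, weightDivChi, h, chiFour_of_mod_four_eq_one h]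
    · simp [weight, weightDivChi, chiFour_of_even]
    · simp [weight, weightDivChi, h, h2, chiFour_of_mod_four_eq_three h]
  · have hk0 : k ≠ 0 := by omega
    rcases prime_mod_four hp with h | rfl | ⟨h, h2⟩
    · rw [chiFour_of_mod_four_eq_one h]
      obtain rfl | hk1 : k = 1 ∨ k ≠ 1 := by omega
      · norm_num [weight, weightDivChi, h]
      · simp [weight, weightDivChi, h, hk0, hk1]
    · rw [chiFour_of_even (by norm_num)]
      simp [weight, weightDivChi]
    · simp [weight, weightDivChi, h, h2, hk0]

/-- The Euler factors of `weightDiv t`. -/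
noncomputable def eulerFactor (t : ℝ) (p : ℕ) : ℝ :=
  if p % 4 = 1 then 1 - 3 / (p : ℝ) ^ 2 + 2 / (p : ℝ) ^ 3
  else if p = 2 then 1 - 1 / 2 + t / 2 ^ 4 - t / 2 ^ 5 else 1 - 1 / (p : ℝ) ^ 2

lemma ofLocal_prime_pow_eq_zero (t : ℝ) {p : ℕ} (hp : p.Prime) {k : ℕ}
    (hk : k ∉ Finset.range 6) : ofLocal (weightDiv t) (p ^ k) = 0 := by
  obtain ⟨j, rfl⟩ : ∃ j, k = j + 1 := ⟨k - 1, by simp at hk; omega⟩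
  rw [ofLocal_prime_pow _ hp]
  simp only [Finset.mem_range, not_lt] at hk
  have h0 : j ≠ 0 := by omega
  have h1 : j ≠ 1 := by omega
  have h2 : j ≠ 2 := by omega
  have h3 : j ≠ 3 := by omega
  have h4 : j ≠ 4 := by omega
  simp [weightDiv, h0, h1, h2, h3, h4]

lemma tsum_prime_pow (t : ℝ) {p : ℕ} (hp : p.Prime) :
    ∑' k, ofLocal (weightDiv t) (p ^ k) / ((p ^ k : ℕ) : ℝ) = eulerFactor t p := by
  rw [tsum_eq_sum (s := Finset.range 6) fun k hk ↦ by
    rw [ofLocal_prime_pow_eq_zero t hp hk, zero_div]]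
  simp only [Finset.sum_range_succ, Finset.sum_range_zero, zero_add]
  rw [pow_zero, (isMultiplicative_ofLocal _).map_one, ofLocal_prime_pow _ hp 1,
    ofLocal_prime_pow _ hp 2, ofLocal_prime_pow _ hp 3, ofLocal_prime_pow _ hp 4,
    ← zero_add 1, ofLocal_prime_pow _ hp 0]
  rcases prime_mod_four hp with h | rfl | ⟨h, h2⟩
  · simp [weightDiv, eulerFactor, h]
    ring
  · norm_num [weightDiv, eulerFactor]
    ring
  · simp [weightDiv, eulerFactor, h, h2]
    ring

/-- At odd primes the linear coefficient has been removed, which leaves `O(1 / p²)`. The constant `5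
+ t` covers `3 + 2` for `p ≡ 1` and all the terms at 2. -/
lemma tsum_abs_prime_pow_le {t : ℝ} (ht : 0 ≤ t) {p : ℕ} (hp : p.Prime) :
    ∑' k, |ofLocal (weightDiv t) (p ^ k) / ((p ^ k : ℕ) : ℝ)| ≤ 1 + (5 + t) / (p : ℝ) ^ 2 := by
  have hp0 : (2 : ℝ) ≤ p := by exact_mod_cast hp.two_le
  rw [tsum_eq_sum (s := Finset.range 6) fun k hk ↦ by
    rw [ofLocal_prime_pow_eq_zero t hp hk, zero_div, abs_zero]]
  simp only [Finset.sum_range_succ, Finset.sum_range_zero, zero_add]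
  rw [pow_zero, (isMultiplicative_ofLocal _).map_one, ofLocal_prime_pow _ hp 1,
    ofLocal_prime_pow _ hp 2, ofLocal_prime_pow _ hp 3, ofLocal_prime_pow _ hp 4,
    ← zero_add 1, ofLocal_prime_pow _ hp 0]
  rcases prime_mod_four hp with h | rfl | ⟨h, h2⟩
  · simp [weightDiv, h, abs_div]
    field_simp
    nlinarith
  · norm_num [weightDiv, abs_div, abs_of_nonneg ht]
    linarith
  · simp [weightDiv, h, h2, abs_div]
    rw [inv_eq_one_div]
    gcongr
    linarith

lemma eulerFactor_pos {t : ℝ} (ht : 0 ≤ t) {p : ℕ} (hp : p.Prime) : 0 < eulerFactor t p := by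
  have hp0 : (2 : ℝ) ≤ p := by exact_mod_cast hp.two_le
  have hsq : 1 / (p : ℝ) ^ 2 ≤ 1 / 2 ^ 2 := by gcongr
  have hcb : 0 < 2 / (p : ℝ) ^ 3 := by positivity
  rw [eulerFactor]
  split_ifs with h1 h2
  · have : 3 / (p : ℝ) ^ 2 = 3 * (1 / (p : ℝ) ^ 2) := by ring
    linarith
  · linarith
  · linarith

lemma summable_const_div_sq (C : ℝ) : Summable fun n : ℕ ↦ C / (n : ℝ) ^ 2 := by
  simpa [div_eq_mul_inv] using (Real.summable_nat_pow_inv.mpr one_lt_two).mul_left C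

lemma summable_abs_ofLocal_weightDiv {t : ℝ} (ht : 0 ≤ t) :
    Summable fun n : ℕ ↦ ‖ofLocal (weightDiv t) n / (n : ℝ)‖ := by
  refine summable_of_multiplicative (e := fun n : ℕ ↦ (5 + t) / (n : ℝ) ^ 2)
    (fun n ↦ norm_nonneg _) (by simp)
    (by simp [(isMultiplicative_ofLocal _).map_one]) (fun {m n} hmn ↦ ?_) (fun {p} hp ↦ ?_)
    (summable_const_div_sq _) (fun n ↦ by positivity) fun p hp ↦ tsum_abs_prime_pow_le ht hp
  · rw [(isMultiplicative_ofLocal _).map_mul_of_coprime hmn, Nat.cast_mul, mul_div_mul_comm,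
      norm_mul]
  · exact summable_of_ne_finset_zero (s := Finset.range 6) fun k hk ↦ by
      rw [ofLocal_prime_pow_eq_zero t hp hk, zero_div, norm_zero]

lemma tsum_ofLocal_weightDiv_pos {t : ℝ} (ht : 0 ≤ t) :
    0 < ∑' n : ℕ, ofLocal (weightDiv t) n / (n : ℝ) := by
  refine tsum_pos_of_multiplicative (f := fun n : ℕ ↦ ofLocal (weightDiv t) n / (n : ℝ)) (by simp)
    (by simp [(isMultiplicative_ofLocal _).map_one])
    (fun {m n} hmn ↦ ?_) (summable_abs_ofLocal_weightDiv ht) (fun p ↦ ?_) ?_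
  · rw [(isMultiplicative_ofLocal _).map_mul_of_coprime hmn, Nat.cast_mul, mul_div_mul_comm]
  · rw [tsum_prime_pow t p.2]
    exact eulerFactor_pos ht p.2
  · refine Summable.of_norm_bounded (g := fun p : Nat.Primes ↦ (5 + t) / ((p : ℕ) : ℝ) ^ 2)
      ((summable_const_div_sq (5 + t)).comp_injective Nat.Primes.coe_nat_injective) fun p ↦ ?_
    rw [tsum_prime_pow t p.2]
    obtain ⟨p, hp⟩ := p
    have hp0 : (2 : ℝ) ≤ p := by exact_mod_cast hp.two_le
    simp only [eulerFactor, Real.norm_eq_abs]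
    have hcb : 2 / (p : ℝ) ^ 3 ≤ 1 / (p : ℝ) ^ 2 := by
      rw [div_le_div_iff₀ (by positivity) (by positivity)]
      nlinarith [sq_nonneg (p : ℝ)]
    have hcb0 : 0 < 2 / (p : ℝ) ^ 3 := by positivity
    have hsq0 : 0 < 1 / (p : ℝ) ^ 2 := by positivity
    have h3 : 3 / (p : ℝ) ^ 2 = 3 * (1 / (p : ℝ) ^ 2) := by ring
    have h5 : (5 + t) / (p : ℝ) ^ 2 = 5 * (1 / (p : ℝ) ^ 2) + t * (1 / (p : ℝ) ^ 2) := by ring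
    have ht2 : 0 ≤ t * (1 / (p : ℝ) ^ 2) := by positivity
    split_ifs with h1 h2
    · rw [abs_le]; constructor <;> linarith
    · subst h2
      rw [abs_le]; constructor <;> norm_num <;> linarith
    · rw [abs_le]; constructor <;> linarith

/-- The mean value of the multiplicative function with local weights `weight t`. -/
theorem exists_tendsto_sum_ofLocal_weight {t : ℝ} (ht : 0 ≤ t) :
    ∃ K : ℝ, 0 < K ∧
      Tendsto (fun N : ℕ ↦ (∑ n ∈ Finset.Ioc 0 N, ofLocal (weight t) n) / N) atTop (𝓝 K) := by
  refine ⟨_, mul_pos (tsum_ofLocal_weightDiv_pos ht) (by positivity : 0 < Real.pi / 4), ?_⟩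
  rw [← ofLocal_weightDivChi_mul_chiFour, ← ofLocal_weightDiv_mul_zeta, mul_assoc,
    mul_comm (ζ : ArithmeticFunction ℝ)]
  exact tendsto_sum_mul_div tendsto_sum_chiFour_mul_zeta (summable_abs_ofLocal_weightDiv ht)

end MultiplicativeSum

/-! ### Factorization of Dirichlet characters over prime powers -/

namespace OrderChar

open DirichletCharacter

lemma coprime_prod_primeFactors_erase {q p : ℕ} (hp : p ∈ q.primeFactors) :
    (p ^ q.factorization p).Coprime (∏ r ∈ q.primeFactors.erase p, r ^ q.factorization r) :=
  Nat.Coprime.prod_right fun _ hr ↦ Nat.Coprime.pow _ _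
    ((Nat.coprime_primes (Nat.prime_of_mem_primeFactors hp)
      (Nat.prime_of_mem_primeFactors (Finset.mem_of_mem_erase hr))).mpr
        (Finset.ne_of_mem_erase hr).symm)

section Factorization

variable {q : ℕ} [NeZero q]

lemma conductor_prod_changeLevel_dvd (ψ : (p : ℕ) → DirichletCharacter ℂ (p ^ q.factorization p))
    (s : Finset ℕ) :
    (∏ p ∈ s, changeLevel (Nat.ordProj_dvd q p) (ψ p)).conductor ∣
      ∏ p ∈ s, p ^ q.factorization p := by
  classical
  induction s using Finset.induction_on with
  | empty => simp [conductor_one]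
  | insert p s hp ih =>
    rw [Finset.prod_insert hp, Finset.prod_insert hp]
    refine (conductor_mul_dvd_lcm_conductor _ _).trans ((Nat.lcm_dvd_mul _ _).trans
      (mul_dvd_mul ?_ ih))
    rw [conductor_changeLevel]
    exact conductor_dvd_level _

/-- The factor at `p` is `χ` times the inverse of the product `ρ` of the others, so its conductor
divides the lcm of those of `χ` and `ρ`; that of `ρ` is prime to `p` and drops out. -/
lemma conductor_dvd_conductor_prod {ψ : (p : ℕ) → DirichletCharacter ℂ (p ^ q.factorization p)}
    {p : ℕ} (hp : p ∈ q.primeFactors) :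
    (ψ p).conductor ∣
      (∏ p ∈ q.primeFactors, changeLevel (Nat.ordProj_dvd q p) (ψ p)).conductor := by
  set χ := ∏ p ∈ q.primeFactors, changeLevel (Nat.ordProj_dvd q p) (ψ p) with hχ
  set ρ := ∏ r ∈ q.primeFactors.erase p, changeLevel (Nat.ordProj_dvd q r) (ψ r) with hρ
  have h1 : changeLevel (Nat.ordProj_dvd q p) (ψ p) = χ * ρ⁻¹ := by
    rw [hχ, ← Finset.mul_prod_erase _ _ hp, mul_inv_cancel_right]
  have h2 : (ψ p).conductor ∣ χ.conductor.lcm ρ.conductor := by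
    rw [← conductor_changeLevel (ψ p) (Nat.ordProj_dvd q p), h1, ← conductor_inv ρ]
    exact conductor_mul_dvd_lcm_conductor _ _
  have h3 : (ψ p).conductor.Coprime ρ.conductor :=
    ((coprime_prod_primeFactors_erase hp).coprime_dvd_left (conductor_dvd_level _)).coprime_dvd_right
      (conductor_prod_changeLevel_dvd ψ _)
  exact h3.dvd_of_dvd_mul_right (h2.trans (Nat.lcm_dvd_mul _ _))

lemma isPrimitive_prod_changeLevel {ψ : (p : ℕ) → DirichletCharacter ℂ (p ^ q.factorization p)}
    (hψ : ∀ p ∈ q.primeFactors, (ψ p).conductor = p ^ q.factorization p) :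
    (∏ p ∈ q.primeFactors, changeLevel (Nat.ordProj_dvd q p) (ψ p)).IsPrimitive := by
  refine Nat.dvd_antisymm (conductor_dvd_level _) ?_
  refine (Nat.dvd_iff_prime_pow_dvd_dvd _ _).mpr fun p k hp hk ↦ ?_
  rcases eq_or_ne k 0 with rfl | hk0
  · simp
  have hmem : p ∈ q.primeFactors :=
    Nat.mem_primeFactors.mpr ⟨hp, (dvd_pow_self p hk0).trans hk, NeZero.ne q⟩
  refine (pow_dvd_pow p ((hp.pow_dvd_iff_le_factorization (NeZero.ne q)).mp hk)).trans ?_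
  rw [← hψ p hmem]
  exact conductor_dvd_conductor_prod hmem

lemma eq_one_of_prod_changeLevel_eq_one
    {ψ : (p : ℕ) → DirichletCharacter ℂ (p ^ q.factorization p)}
    (h : ∏ p ∈ q.primeFactors, changeLevel (Nat.ordProj_dvd q p) (ψ p) = 1)
    {p : ℕ} (hp : p ∈ q.primeFactors) : ψ p = 1 := by
  have h1 := conductor_dvd_conductor_prod (ψ := ψ) hp
  rw [h, conductor_one, Nat.dvd_one] at h1
  have : NeZero (p ^ q.factorization p) :=
    ⟨pow_ne_zero _ (Nat.prime_of_mem_primeFactors hp).ne_zero⟩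
  exact eq_one_iff_conductor_eq_one.mpr h1

lemma prod_changeLevel_injective
    {ψ φ : (p : ℕ) → DirichletCharacter ℂ (p ^ q.factorization p)}
    (h : ∏ p ∈ q.primeFactors, changeLevel (Nat.ordProj_dvd q p) (ψ p) =
      ∏ p ∈ q.primeFactors, changeLevel (Nat.ordProj_dvd q p) (φ p))
    {p : ℕ} (hp : p ∈ q.primeFactors) : ψ p = φ p := by
  refine mul_inv_eq_one.mp (eq_one_of_prod_changeLevel_eq_one (ψ := fun p ↦ ψ p * (φ p)⁻¹) ?_ hp)
  simp only [map_mul, map_inv, Finset.prod_mul_distrib, Finset.prod_inv_distrib]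
  rw [h, mul_inv_cancel]

/-- A power of the product is trivial exactly when that power of every factor is. For `q = 1` the
empty product has order 1, whatever `l` is. -/
lemma orderOf_prod_changeLevel {ψ : (p : ℕ) → DirichletCharacter ℂ (p ^ q.factorization p)}
    {l : ℕ} (hψ : ∀ p ∈ q.primeFactors, orderOf (ψ p) = l) (hq : q ≠ 1) :
    orderOf (∏ p ∈ q.primeFactors, changeLevel (Nat.ordProj_dvd q p) (ψ p)) = l := by
  obtain ⟨p, hp⟩ := Nat.nonempty_primeFactors.mpr
    (lt_of_le_of_ne (Nat.pos_of_ne_zero (NeZero.ne q)) hq.symm)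
  rw [← hψ p hp, orderOf_eq_orderOf_iff]
  intro n
  have hpow : (∏ p ∈ q.primeFactors, changeLevel (Nat.ordProj_dvd q p) (ψ p)) ^ n =
      ∏ p ∈ q.primeFactors, changeLevel (Nat.ordProj_dvd q p) (ψ p ^ n) := by
    simp [Finset.prod_pow]
  rw [hpow]
  refine ⟨fun h ↦ eq_one_of_prod_changeLevel_eq_one (ψ := fun p ↦ ψ p ^ n) h hp, fun h ↦ ?_⟩
  refine Finset.prod_eq_one fun r hr ↦ ?_
  rw [← orderOf_dvd_iff_pow_eq_one, hψ p hp, ← hψ r hr, orderOf_dvd_iff_pow_eq_one] at h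
  rw [h, map_one]

/-- The primitive characters of order `l` and level `q`. -/
def localChars (l q : ℕ) : Set (DirichletCharacter ℂ q) :=
  {χ | χ.IsPrimitive ∧ orderOf χ = l}

/-- The primitive characters of level `q` that are totally of order `l`. -/
def totalChars (l q : ℕ) : Set (DirichletCharacter ℂ q) :=
  {χ | (χ.IsPrimitive ∧ orderOf χ = l) ∧ IsTotallyOfOrder χ l}

lemma ncard_totalChars {l : ℕ} (hq : q ≠ 1) :
    (totalChars l q).ncard =
      ∏ p ∈ q.primeFactors, (localChars l (p ^ q.factorization p)).ncard := by
  classical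
  -- A family indexed by the prime factors is extended to all of `ℕ` by trivial characters, to match
  -- the type in `IsTotallyOfOrder`.
  let ext (ψ : (p : q.primeFactors) → localChars l ((p : ℕ) ^ q.factorization p)) (p : ℕ) :
      DirichletCharacter ℂ (p ^ q.factorization p) :=
    if h : p ∈ q.primeFactors then (ψ ⟨p, h⟩).1 else 1
  have hext (ψ) (p : ℕ) (h : p ∈ q.primeFactors) : ext ψ p = (ψ ⟨p, h⟩).1 := dif_pos h
  have hcond (ψ) (p : ℕ) (h : p ∈ q.primeFactors) :
      (ext ψ p).conductor = p ^ q.factorization p := by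
    rw [hext ψ p h]
    exact (ψ ⟨p, h⟩).2.1
  have hord (ψ) (p : ℕ) (h : p ∈ q.primeFactors) : orderOf (ext ψ p) = l := by
    rw [hext ψ p h]
    exact (ψ ⟨p, h⟩).2.2
  let f (ψ : (p : q.primeFactors) → localChars l ((p : ℕ) ^ q.factorization p)) :
      totalChars l q :=
    ⟨∏ p ∈ q.primeFactors, changeLevel (Nat.ordProj_dvd q p) (ext ψ p),
      ⟨isPrimitive_prod_changeLevel (hcond ψ), orderOf_prod_changeLevel (hord ψ) hq⟩,
      ext ψ, rfl, fun p hp ↦ ⟨hcond ψ p hp, hord ψ p hp⟩⟩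
  have hf : Function.Bijective f := by
    refine ⟨fun ψ φ h ↦ ?_, fun ⟨χ, hχ, ψ, hprod, hψ⟩ ↦ ?_⟩
    · funext ⟨p, hp⟩
      have := prod_changeLevel_injective (congrArg Subtype.val h) hp
      rw [hext ψ p hp, hext φ p hp] at this
      exact Subtype.ext this
    · refine ⟨fun p ↦ ⟨ψ p, hψ p p.2⟩, Subtype.ext ?_⟩
      simp only [f]
      rw [hprod]
      exact Finset.prod_congr rfl fun p hp ↦ congrArg _ (dif_pos hp)
  have := Nat.card_congr (Equiv.ofBijective f hf)
  rw [Nat.card_pi, Nat.card_coe_set_eq] at this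
  rw [← this, ← Finset.prod_coe_sort q.primeFactors
    fun p ↦ (localChars l (p ^ q.factorization p)).ncard]
  exact Finset.prod_congr rfl fun p _ ↦ Nat.card_coe_set_eq _

end Factorization

/-! ### Characters of order `4` modulo prime powers -/

section Local

lemma localChars_eq_of_prime {p : ℕ} (hp : p.Prime) {l : ℕ} (hl : l ≠ 1) :
    localChars l p = {χ | orderOf χ = l} := by
  have : NeZero p := ⟨hp.ne_zero⟩
  ext χ
  refine ⟨fun h ↦ h.2, fun h ↦ ⟨?_, h⟩⟩
  refine ((Nat.dvd_prime hp).mp χ.conductor_dvd_level).resolve_left fun h1 ↦ hl ?_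
  rw [← (show orderOf χ = l from h), eq_one_iff_conductor_eq_one.mpr h1, orderOf_one]

/-- A finite abelian group is (non-canonically) isomorphic to its dual. -/
lemma ncard_setOf_orderOf_eq {n : ℕ} [NeZero n] (l : ℕ) :
    {χ : DirichletCharacter ℂ n | orderOf χ = l}.ncard =
      {u : (ZMod n)ˣ | orderOf u = l}.ncard := by
  obtain ⟨e⟩ := MulChar.mulEquiv_units (ZMod n) ℂ
  refine Set.ncard_congr (fun χ _ ↦ e χ) (fun χ hχ ↦ ?_) (fun χ φ _ _ h ↦ e.injective h)
    fun u hu ↦ ⟨e.symm u, ?_, e.apply_symm_apply u⟩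
  · exact (MulEquiv.orderOf_eq e χ).trans hχ
  · exact (MulEquiv.orderOf_eq e.symm u).trans hu

lemma ncard_localChars_four_of_prime {p : ℕ} (hp : p.Prime) :
    (localChars 4 p).ncard = if p % 4 = 1 then 2 else 0 := by
  have : Fact p.Prime := ⟨hp⟩
  rw [localChars_eq_of_prime hp (by norm_num), ncard_setOf_orderOf_eq]
  have hcard : Fintype.card (ZMod p)ˣ = p - 1 := ZMod.card_units p
  split_ifs with h
  · have := IsCyclic.card_orderOf_eq_totient (α := (ZMod p)ˣ) (d := 4)
      (by rw [hcard]; have := hp.two_le; omega)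
    rw [Set.ncard_eq_toFinset_card', show Nat.totient 4 = 2 by decide] at *
    rw [← this]
    congr 1
    ext u
    simp
  · rw [Set.ncard_eq_zero]
    refine Set.eq_empty_iff_forall_notMem.mpr fun u hu ↦ h ?_
    have h4 : 4 ∣ p - 1 := by
      rw [← hcard, ← (show orderOf u = 4 from hu)]
      exact orderOf_dvd_card
    have := hp.two_le
    omega

lemma apply_pow_orderOf {n : ℕ} (χ : DirichletCharacter ℂ n) (u : (ZMod n)ˣ) :
    χ.toUnitHom u ^ orderOf χ = 1 := by
  ext
  rw [Units.val_pow_eq_pow_val, MulChar.coe_toUnitHom, ← MulChar.pow_apply_coe, pow_orderOf_eq_one,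
    MulChar.one_apply_coe, Units.val_one]

/-- The kernel of reduction to level `p` is a `p`-group, on which a character of order 4 is trivial
as `p` is odd. So the character factors through level `p` and is not primitive. -/
lemma localChars_four_eq_empty_of_odd {p k : ℕ} (hp : p.Prime) (hp2 : p ≠ 2) :
    localChars 4 (p ^ (k + 2)) = ∅ := by
  refine Set.eq_empty_iff_forall_notMem.mpr fun χ ⟨hχ, hord⟩ ↦ ?_
  have : NeZero (p ^ (k + 2)) := ⟨pow_ne_zero _ hp.ne_zero⟩
  have hdvd : p ∣ p ^ (k + 2) := dvd_pow_self p (by omega)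
  have hfac : χ.FactorsThrough p := by
    refine (factorsThrough_iff_ker_unitsMap hdvd).mpr fun u hu ↦ ?_
    have hu1 : u ^ p ^ (k + 1) = 1 := by
      ext
      have h1 : ((u : ZMod (p ^ (k + 2))).val : ZMod p) = 1 := by
        have := congrArg Units.val (MonoidHom.mem_ker.mp hu)
        rw [ZMod.unitsMap_val, ZMod.cast_eq_val] at this
        exact this
      have h2 : (p : ℤ) ∣ ((u : ZMod (p ^ (k + 2))).val : ℤ) - 1 := by
        rw [← ZMod.intCast_zmod_eq_zero_iff_dvd]
        push_cast
        rw [h1, sub_self]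
      have h3 := dvd_sub_pow_of_dvd_sub h2 (k + 1)
      rw [one_pow] at h3
      have h4 := (ZMod.intCast_zmod_eq_zero_iff_dvd _ (p ^ (k + 2))).mpr (by exact_mod_cast h3)
      push_cast at h4
      rw [ZMod.natCast_zmod_val, sub_eq_zero] at h4
      simpa using h4
    rw [MonoidHom.mem_ker]
    have h5 : χ.toUnitHom u ^ p ^ (k + 1) = 1 := by rw [← map_pow, hu1, map_one]
    have h6 := apply_pow_orderOf χ u
    rw [hord] at h6
    rw [← orderOf_eq_one_iff, ← Nat.dvd_one]
    have hcop : Nat.Coprime 4 (p ^ (k + 1)) :=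
      Nat.Coprime.pow_right _ (Nat.Coprime.pow_left 2
        ((Nat.coprime_primes Nat.prime_two hp).mpr hp2.symm))
    rw [← Nat.Coprime.gcd_eq_one hcop]
    exact Nat.dvd_gcd (orderOf_dvd_of_pow_eq_one h6) (orderOf_dvd_of_pow_eq_one h5)
  have h := conductor_dvd_of_mem_conductorSet χ hfac
  rw [show χ.conductor = p ^ (k + 2) from hχ] at h
  have := Nat.le_of_dvd hp.pos h
  have h2 : p ^ 2 ≤ p ^ (k + 2) := Nat.pow_le_pow_right hp.pos (by omega)
  nlinarith [hp.two_le]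

lemma sq_eq_one_of_dvd_eight {n : ℕ} (hn : n ∣ 8) (χ : DirichletCharacter ℂ n) : χ ^ 2 = 1 := by
  have h8 (φ : DirichletCharacter ℂ 8) : φ ^ 2 = 1 := by
    ext u
    have hu : u ^ 2 = 1 := by revert u; decide
    rw [MulChar.pow_apply_coe, MulChar.one_apply_coe, ← map_pow, ← Units.val_pow_eq_pow_val, hu,
      Units.val_one, map_one]
  apply changeLevel_injective hn
  rw [map_pow, h8, map_one]

lemma orderOf_ne_four_of_dvd_eight {n : ℕ} (hn : n ∣ 8) (χ : DirichletCharacter ℂ n) :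
    orderOf χ ≠ 4 := fun h ↦ by
  have := orderOf_dvd_of_pow_eq_one (sq_eq_one_of_dvd_eight hn χ)
  rw [h] at this
  omega

lemma localChars_four_eq_empty_of_dvd_eight {n : ℕ} (hn : n ∣ 8) : localChars 4 n = ∅ :=
  Set.eq_empty_iff_forall_notMem.mpr fun χ h ↦ orderOf_ne_four_of_dvd_eight hn χ h.2

/-- An imprimitive character modulo 16 comes from a level dividing 8, where all squares are trivial;
so order 4 forces primitivity. The unit group has exponent 4 and four elements of order 4. -/
lemma ncard_localChars_four_two_pow_four : (localChars 4 (2 ^ 4)).ncard = 4 := by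
  have h : localChars 4 (2 ^ 4) = {χ | orderOf χ = 4} := by
    ext χ
    refine ⟨fun h ↦ h.2, fun h ↦ ⟨?_, h⟩⟩
    obtain ⟨j, hj, hc⟩ := (Nat.dvd_prime_pow Nat.prime_two).mp χ.conductor_dvd_level
    rcases eq_or_lt_of_le hj with rfl | hj
    · exact hc
    · have h8 : χ.conductor ∣ 8 := by
        rw [hc, show 8 = 2 ^ 3 by norm_num]
        exact pow_dvd_pow 2 (by omega)
      have h2 : χ ^ 2 = 1 := by
        rw [← changeLevel_primitiveCharacter χ, ← map_pow,
          sq_eq_one_of_dvd_eight h8, map_one]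
      have := orderOf_dvd_of_pow_eq_one h2
      rw [show orderOf χ = 4 from h] at this
      omega
  rw [h, ncard_setOf_orderOf_eq]
  have h4 : {u : (ZMod (2 ^ 4))ˣ | orderOf u = 4} =
      ((Finset.univ.filter fun u : (ZMod (2 ^ 4))ˣ ↦ ¬u ^ 2 = 1 : Finset _) : Set _) := by
    ext u
    simp only [Set.mem_ofPred_eq, Finset.coe_filter, Finset.mem_univ, true_and]
    constructor
    · intro hu h2
      have := orderOf_dvd_of_pow_eq_one h2
      rw [hu] at this
      omega
    · intro hu
      have hu4 : u ^ 2 ^ (1 + 1) = 1 := by revert u; decide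
      exact orderOf_eq_prime_pow (p := 2) (n := 1) (by simpa using hu) hu4
  rw [h4, Set.ncard_coe_finset]
  decide

/-- Modulo `2 ^ (k + 5)`, every unit `≡ 1` mod `2 ^ (k + 4)` is a fourth power, hence killed by a
character of order 4, which therefore factors through `2 ^ (k + 4)`. -/
lemma localChars_four_eq_empty_of_two_pow (k : ℕ) : localChars 4 (2 ^ (k + 5)) = ∅ := by
  refine Set.eq_empty_iff_forall_notMem.mpr fun χ ⟨hχ, hord⟩ ↦ ?_
  have hdvd : 2 ^ (k + 4) ∣ 2 ^ (k + 5) := pow_dvd_pow 2 (by omega)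
  have hfac : χ.FactorsThrough (2 ^ (k + 4)) := by
    refine (factorsThrough_iff_ker_unitsMap hdvd).mpr fun u hu ↦ ?_
    have h1 : ((u : ZMod (2 ^ (k + 5))).val : ZMod (2 ^ (k + 4))) = 1 := by
      have := congrArg Units.val (MonoidHom.mem_ker.mp hu)
      rw [ZMod.unitsMap_val, ZMod.cast_eq_val] at this
      exact this
    have h2 : ((2 ^ (k + 4) : ℕ) : ℤ) ∣ ((u : ZMod (2 ^ (k + 5))).val : ℤ) - 1 := by
      rw [← ZMod.intCast_zmod_eq_zero_iff_dvd]
      push_cast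
      rw [h1, sub_self]
    obtain ⟨c, hc⟩ := h2
    have hu4 : (u : ZMod (2 ^ (k + 5))) = ((1 + 4 * 2 ^ k * c : ℤ) : ZMod (2 ^ (k + 5))) ^ 4 := by
      have h3 : (u : ZMod (2 ^ (k + 5))) =
          ((((u : ZMod (2 ^ (k + 5))).val : ℤ)) : ZMod (2 ^ (k + 5))) := by
        rw [Int.cast_natCast, ZMod.natCast_zmod_val]
      rw [h3, ← Int.cast_pow, ZMod.intCast_eq_intCast_iff_dvd_sub, eq_add_of_sub_eq hc]
      -- With `y = 2 ^ k * c`, `(1 + 4y)^4 - (1 + 16y) = 32 y² (3 + 8y + 8y²)`; the witness is this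
      -- divided by `2 ^ (k + 5)`.
      refine ⟨2 ^ k * c ^ 2 * (3 + 8 * 2 ^ k * c + 8 * (2 ^ k * c) ^ 2), ?_⟩
      push_cast
      ring
    have hunit : IsUnit ((1 + 4 * 2 ^ k * c : ℤ) : ZMod (2 ^ (k + 5))) := by
      rw [← isUnit_pow_iff (n := 4) (by norm_num), ← hu4]
      exact u.isUnit
    have hu5 : u = hunit.unit ^ 4 := by
      ext
      rw [hu4, Units.val_pow_eq_pow_val, IsUnit.unit_spec]
    have := apply_pow_orderOf χ hunit.unit
    rw [hord] at this
    rw [MonoidHom.mem_ker, hu5, map_pow, this]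
  have h := conductor_dvd_of_mem_conductorSet χ hfac
  rw [show χ.conductor = 2 ^ (k + 5) from hχ, Nat.pow_dvd_pow_iff_le_right (by norm_num)] at h
  omega

lemma ncard_localChars_four {p : ℕ} (hp : p.Prime) {k : ℕ} (hk : k ≠ 0) :
    ((localChars 4 (p ^ k)).ncard : ℝ) = MultiplicativeSum.weight 4 p k := by
  rcases eq_or_ne p 2 with rfl | hp2
  · obtain h3 | rfl | h5 : k ≤ 3 ∨ k = 4 ∨ 5 ≤ k := by omega
    · rw [localChars_four_eq_empty_of_dvd_eight (by
        rw [show 8 = 2 ^ 3 by norm_num]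
        exact pow_dvd_pow 2 h3)]
      have : k ≠ 4 := by omega
      simp [MultiplicativeSum.weight, this]
    · rw [ncard_localChars_four_two_pow_four]
      simp [MultiplicativeSum.weight]
    · obtain ⟨j, rfl⟩ := Nat.exists_eq_add_of_le' h5
      rw [localChars_four_eq_empty_of_two_pow]
      simp [MultiplicativeSum.weight]
  · obtain rfl | h2 : k = 1 ∨ 2 ≤ k := by omega
    · rw [pow_one, ncard_localChars_four_of_prime hp]
      simp [MultiplicativeSum.weight, hp2]
    · obtain ⟨j, rfl⟩ := Nat.exists_eq_add_of_le' h2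
      rw [localChars_four_eq_empty_of_odd hp hp2]
      simp [MultiplicativeSum.weight, hp2]

lemma ncard_totalChars_four {q : ℕ} (hq : 1 < q) :
    ((totalChars 4 q).ncard : ℝ) = MultiplicativeSum.ofLocal (MultiplicativeSum.weight 4) q := by
  have : NeZero q := ⟨by omega⟩
  rw [ncard_totalChars hq.ne', MultiplicativeSum.ofLocal_apply _ (NeZero.ne q), Nat.cast_prod]
  refine Finset.prod_congr rfl fun p hp ↦ ncard_localChars_four (Nat.prime_of_mem_primeFactors hp) ?_
  exact ((Nat.prime_of_mem_primeFactors hp).factorization_pos_of_dvd (NeZero.ne q)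
    (Nat.dvd_of_mem_primeFactors hp)).ne'

end Local

end OrderChar

/-! ### Counting characters by conductor -/

namespace OrderChar

open Filter Topology

lemma ncard_setOf_sigma_eq_sum {S : (q : ℕ) → Set (DirichletCharacter ℂ q)} (N : ℕ) :
    {χ : Σ q : ℕ, DirichletCharacter ℂ q | χ.1 ∈ Finset.Ioc 0 N ∧ χ.2 ∈ S χ.1}.ncard =
      ∑ q ∈ Finset.Ioc 0 N, (S q).ncard := by
  classical
  have hfin {q : ℕ} (hq : q ∈ Finset.Ioc 0 N) : (S q).Finite := by
    have : NeZero q := ⟨(Finset.mem_Ioc.mp hq).1.ne'⟩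
    exact Set.toFinite _
  let T (q : ℕ) : Finset (DirichletCharacter ℂ q) :=
    if h : (S q).Finite then h.toFinset else ∅
  have hT {q : ℕ} (hq : q ∈ Finset.Ioc 0 N) : (T q : Set (DirichletCharacter ℂ q)) = S q := by
    simp [T, hfin hq]
  have h : {χ : Σ q : ℕ, DirichletCharacter ℂ q | χ.1 ∈ Finset.Ioc 0 N ∧ χ.2 ∈ S χ.1} =
      ((Finset.Ioc 0 N).sigma T : Set (Σ q : ℕ, DirichletCharacter ℂ q)) := by
    ext ⟨q, χ⟩
    simp only [Set.mem_ofPred_eq, Finset.mem_coe, Finset.mem_sigma]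
    refine and_congr_right fun hq ↦ ?_
    rw [← Finset.mem_coe, hT hq]
  rw [h, Set.ncard_coe_finset, Finset.card_sigma]
  refine Finset.sum_congr rfl fun q hq ↦ ?_
  rw [← hT hq, Set.ncard_coe_finset]

lemma ncard_upTo {Ψ : Set (Σ q : ℕ, DirichletCharacter ℂ q)}
    {S : (q : ℕ) → Set (DirichletCharacter ℂ q)}
    (h : ∀ q χ, ⟨q, χ⟩ ∈ Ψ ↔ 0 < q ∧ χ ∈ S q) (hS : ∀ q, ∀ χ ∈ S q, χ.IsPrimitive) (X : ℝ) :
    (upTo Ψ X).ncard = ∑ q ∈ Finset.Ioc 0 ⌊X⌋₊, (S q).ncard := by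
  rw [← ncard_setOf_sigma_eq_sum]
  congr 1
  ext ⟨q, χ⟩
  simp only [upTo, Set.mem_ofPred_eq, Finset.mem_Ioc, h]
  constructor
  · rintro ⟨⟨hq, hχ⟩, hX⟩
    rw [show χ.conductor = q from hS q χ hχ] at hX
    exact ⟨⟨hq, Nat.le_floor hX⟩, hχ⟩
  · rintro ⟨⟨hq, hX⟩, hχ⟩
    refine ⟨⟨hq, hχ⟩, ?_⟩
    rw [show χ.conductor = q from hS q χ hχ]
    exact (Nat.le_floor_iff' hq.ne').mp hX

lemma totalChars_four_one : totalChars 4 1 = ∅ := by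
  refine Set.eq_empty_iff_forall_notMem.mpr fun χ hχ ↦ ?_
  have := hχ.1.2
  rw [DirichletCharacter.level_one χ, orderOf_one] at this
  omega

/-- The `- 1` removes the term at 1, where a multiplicative function is 1 although no character of
level 1 has order 4. -/
lemma isEquivalent_of_tendsto_sum {f : ℝ → ℝ} {a : ℕ → ℝ} {K : ℝ} (hK : 0 < K)
    (ha : Tendsto (fun N : ℕ ↦ (∑ n ∈ Finset.Ioc 0 N, a n) / N) atTop (𝓝 K))
    (hf : ∀ X, 1 ≤ X → f X = (∑ n ∈ Finset.Ioc 0 ⌊X⌋₊, a n) - 1) :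
    Asymptotics.IsEquivalent atTop f fun X ↦ K * X := by
  refine (Asymptotics.isEquivalent_iff_tendsto_one ?_).mpr ?_
  · filter_upwards [eventually_gt_atTop 0] with X hX using (mul_pos hK hX).ne'
  · have h1 := (ha.comp (tendsto_nat_floor_atTop (α := ℝ))).mul
      (tendsto_nat_floor_div_atTop (R := ℝ))
    have h2 := (h1.sub tendsto_inv_atTop_zero).div_const K
    rw [mul_one, sub_zero, div_self hK.ne'] at h2
    refine h2.congr' ?_
    filter_upwards [eventually_ge_atTop 1] with X hX
    have hN : (⌊X⌋₊ : ℝ) ≠ 0 := by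
      have := Nat.floor_pos.mpr hX
      positivity
    simp only [Pi.div_apply, Function.comp_apply, hf X hX]
    field_simp

/-! ### The three families of quartic characters -/

lemma mem_psiTot_iff (q : ℕ) (χ : DirichletCharacter ℂ q) :
    ⟨q, χ⟩ ∈ PsiTot 4 ↔ 0 < q ∧ χ ∈ totalChars 4 q := by
  simp only [PsiTot, Psi, totalChars, Set.mem_ofPred_eq]
  tauto

lemma mem_psiTotOdd_iff (q : ℕ) (χ : DirichletCharacter ℂ q) :
    ⟨q, χ⟩ ∈ PsiTotOdd 4 ↔ 0 < q ∧ χ ∈ {χ | χ ∈ totalChars 4 q ∧ Odd q} := by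
  simp only [PsiTotOdd, Set.mem_ofPred_eq, mem_psiTot_iff]
  rw [and_assoc]
  refine and_congr_right fun _ ↦ and_congr_right fun hχ ↦ ?_
  rw [show χ.conductor = q from hχ.1.1]

lemma mem_psiPrime_iff (q : ℕ) (χ : DirichletCharacter ℂ q) :
    ⟨q, χ⟩ ∈ PsiPrime 4 ↔ 0 < q ∧ χ ∈ {χ | χ ∈ localChars 4 q ∧ q.Prime} := by
  simp only [PsiPrime, Psi, localChars, Set.mem_ofPred_eq]
  rw [and_assoc]
  refine and_congr_right fun _ ↦ and_congr_right fun hχ ↦ ?_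
  rw [show χ.conductor = q from hχ.1]

/-- Together with the vanishing at even `q`, this shows that `t = 0` selects the odd conductors. -/
lemma ofLocal_weight_zero_of_odd {q : ℕ} (hq : Odd q) :
    MultiplicativeSum.ofLocal (MultiplicativeSum.weight 0) q =
      MultiplicativeSum.ofLocal (MultiplicativeSum.weight 4) q := by
  have h0 : q ≠ 0 := hq.pos.ne'
  rw [MultiplicativeSum.ofLocal_apply _ h0, MultiplicativeSum.ofLocal_apply _ h0]
  refine Finset.prod_congr rfl fun p hp ↦ ?_
  have hp2 : p ≠ 2 := by
    rintro rfl
    exact (Nat.not_even_iff_odd.mpr hq) (even_iff_two_dvd.mpr (Nat.dvd_of_mem_primeFactors hp))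
  simp [MultiplicativeSum.weight, hp2]

lemma ofLocal_weight_zero_of_even {q : ℕ} (hq : Even q) :
    MultiplicativeSum.ofLocal (MultiplicativeSum.weight 0) q = 0 := by
  rcases eq_or_ne q 0 with rfl | h0
  · simp
  rw [MultiplicativeSum.ofLocal_apply _ h0]
  refine Finset.prod_eq_zero (i := 2)
    (Nat.mem_primeFactors.mpr ⟨Nat.prime_two, even_iff_two_dvd.mp hq, h0⟩) ?_
  simp [MultiplicativeSum.weight]

lemma ncard_upTo_psiTot {X : ℝ} (hX : 1 ≤ X) :
    ((upTo (PsiTot 4) X).ncard : ℝ) = (∑ q ∈ Finset.Ioc 0 ⌊X⌋₊,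
      MultiplicativeSum.ofLocal (MultiplicativeSum.weight 4) q) - 1 := by
  have h1 : 1 ∈ Finset.Ioc 0 ⌊X⌋₊ := Finset.mem_Ioc.mpr ⟨one_pos, Nat.floor_pos.mpr hX⟩
  rw [ncard_upTo mem_psiTot_iff fun q χ h ↦ h.1.1, Nat.cast_sum,
    ← Finset.add_sum_erase _ _ h1, ← Finset.add_sum_erase _ _ h1, totalChars_four_one,
    (MultiplicativeSum.isMultiplicative_ofLocal _).map_one, Set.ncard_empty, Nat.cast_zero,
    zero_add, add_sub_cancel_left]
  refine Finset.sum_congr rfl fun q hq ↦ ncard_totalChars_four ?_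
  simp only [Finset.mem_erase, Finset.mem_Ioc] at hq
  omega

lemma ncard_upTo_psiTotOdd {X : ℝ} (hX : 1 ≤ X) :
    ((upTo (PsiTotOdd 4) X).ncard : ℝ) = (∑ q ∈ Finset.Ioc 0 ⌊X⌋₊,
      MultiplicativeSum.ofLocal (MultiplicativeSum.weight 0) q) - 1 := by
  have h1 : 1 ∈ Finset.Ioc 0 ⌊X⌋₊ := Finset.mem_Ioc.mpr ⟨one_pos, Nat.floor_pos.mpr hX⟩
  rw [ncard_upTo mem_psiTotOdd_iff fun q χ h ↦ h.1.1.1, Nat.cast_sum,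
    ← Finset.add_sum_erase _ _ h1, ← Finset.add_sum_erase _ _ h1, totalChars_four_one,
    (MultiplicativeSum.isMultiplicative_ofLocal _).map_one]
  simp only [Set.mem_empty_iff_false, false_and, Set.ofPred_false, Set.ncard_empty, Nat.cast_zero,
    zero_add, add_sub_cancel_left]
  refine Finset.sum_congr rfl fun q hq ↦ ?_
  simp only [Finset.mem_erase, Finset.mem_Ioc] at hq
  rcases Nat.even_or_odd q with he | ho
  · simp [ofLocal_weight_zero_of_even he, Nat.not_odd_iff_even.mpr he]
  · simp only [ho, and_true, Set.ofPred_mem_eq]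
    rw [ofLocal_weight_zero_of_odd ho]
    exact ncard_totalChars_four (by omega)

lemma ncard_upTo_psiPrime (X : ℝ) :
    (upTo (PsiPrime 4) X).ncard = 2 * (PrimesMod.primesMod (1 : ZMod 4) X).card := by
  rw [ncard_upTo mem_psiPrime_iff fun q χ h ↦ h.1.1, PrimesMod.primesMod,
    PrimesMod.primesLE_eq_filter_Ioc, Finset.filter_filter, Finset.card_filter, Finset.mul_sum]
  refine Finset.sum_congr rfl fun q hq ↦ ?_
  by_cases hp : q.Prime
  · have h4 : (q : ZMod 4) = 1 ↔ q % 4 = 1 := by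
      have := ZMod.natCast_eq_natCast_iff' q 1 4
      simpa using this
    simp only [hp, and_true, true_and, Set.ofPred_mem_eq, h4]
    rw [ncard_localChars_four_of_prime hp]
    split_ifs <;> rfl
  · simp [hp]

theorem isEquivalent_ncard_upTo_psiPrime :
    Asymptotics.IsEquivalent atTop (fun X : ℝ ↦ ((upTo (PsiPrime 4) X).ncard : ℝ))
      fun X : ℝ ↦ X / Real.log X := by
  have h := (PrimesMod.tendsto_card_primesMod (a := (1 : ZMod 4)) isUnit_one).const_mul 2
  -- Two characters per prime and density `1 / φ(4) = 1 / 2` give the constant 1.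
  rw [show Nat.totient 4 = 2 by decide, Nat.cast_ofNat, mul_inv_cancel₀ two_ne_zero] at h
  refine (Asymptotics.isEquivalent_iff_tendsto_one ?_).mpr (h.congr' ?_)
  · filter_upwards [eventually_gt_atTop 1] with X hX
    exact (div_pos (by linarith) (Real.log_pos hX)).ne'
  · filter_upwards [eventually_gt_atTop 1] with X hX
    have := Real.log_pos hX
    simp only [Pi.div_apply, ncard_upTo_psiPrime]
    push_cast
    field_simp

end OrderChar

theorem mainTheorem3 :
    (∃ K Kodd : ℝ, 0 < K ∧ 0 < Kodd ∧
      Asymptotics.IsEquivalent Filter.atTop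
        (fun X : ℝ ↦ ((OrderChar.upTo (OrderChar.PsiTot 4) X).ncard : ℝ))
        (fun X : ℝ ↦ K * X) ∧
      Asymptotics.IsEquivalent Filter.atTop
        (fun X : ℝ ↦ ((OrderChar.upTo (OrderChar.PsiTotOdd 4) X).ncard : ℝ))
        (fun X : ℝ ↦ Kodd * X)) ∧
    Asymptotics.IsEquivalent Filter.atTop
      (fun X : ℝ ↦ ((OrderChar.upTo (OrderChar.PsiPrime 4) X).ncard : ℝ))
      (fun X : ℝ ↦ X / Real.log X) := by
  obtain ⟨K, hK, hK'⟩ :=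
    MultiplicativeSum.exists_tendsto_sum_ofLocal_weight (t := 4) (by norm_num)
  obtain ⟨Kodd, hKodd, hKodd'⟩ :=
    MultiplicativeSum.exists_tendsto_sum_ofLocal_weight (t := 0) le_rfl
  exact ⟨⟨K, Kodd, hK, hKodd,
    OrderChar.isEquivalent_of_tendsto_sum hK hK' fun X hX ↦ OrderChar.ncard_upTo_psiTot hX,
    OrderChar.isEquivalent_of_tendsto_sum hKodd hKodd'
      fun X hX ↦ OrderChar.ncard_upTo_psiTotOdd hX⟩,
    OrderChar.isEquivalent_ncard_upTo_psiPrime⟩
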